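/- All manifolds are smooth, finite-dimensional, without boundary, Hausdorff and second countable; a Lie groupoid $\mathbb X=[X_1\rightrightarrows X_0]$ has smooth structure maps and source $s$ and target $t$ that are surjective submersions; $\gamma_2\circ\gamma_1$ is defined when $s(\gamma_2)=t(\gamma_1)$. Let $(G,H,\tau,\alpha)$ be a Lie crossed module: $G,H$ are Lie groups, $\tau\colon H\to G$ is a homomorphism of Lie groups, and $\alpha\colon G\times H\to H$, $\alpha(g,h)=\alpha_g(h)$, is a smooth action of $G$ on $H$ by group automorphisms, with $\tau(\alpha_g(h))=g\tau(h)g^{-1}$ and $\alpha_{\tau(h)}(h')=hh'h^{-1}$. Let $\mathbb G=[H\rtimes_\alpha G\rightrightarrows G]$ be the associated Lie 2-group, with source $(h,g)\mapsto g$, target $(h,g)\mapsto\tau(h)g$, composition $(h_2,g_2)\circ(h_1,g_1)=(h_2h_1,g_1)$, and group multiplication $(h_2,g_2)(h_1,g_1)=(h_2\,\alpha_{g_2}(h_1),g_2g_1)$ on morphisms. Let $\pi\colon E_G\to X_0$ be a principal $G$-bundle over the Lie groupoid $\mathbb X$, that is, a (smooth, locally trivial, right) principal $G$-bundle with a smooth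 map $\mu\colon X_1\times_{s,X_0,\pi}E_G\to E_G$ such that $\mu(1_{\pi(p)},p)=p$, $\pi(\mu(\gamma,p))=t(\gamma)$, $\mu(\gamma_2\circ\gamma_1,p)=\mu(\gamma_2,\mu(\gamma_1,p))$ and $\mu(\gamma,p)g=\mu(\gamma,pg)$. Write $s^*E_G=X_1\times_{s,X_0,\pi}E_G=\{(\gamma,p): s(\gamma)=\pi(p)\}$. Then $s^*E_G$ is an embedded submanifold of $X_1\times E_G$, and with this manifold structure: 1. The manifolds $s^*E_G\times H$ and $E_G$ form a Lie groupoid $\mathbb E^{\rm dec}=[s^*E_G\times H\rightrightarrows E_G]$ with source $(\gamma,p,h)\mapsto p$, target $(\gamma,p,h)\mapsto\mu(\gamma,p)\,\tau(h^{-1})$, composition $(\gamma_2,p_2,h_2)\circ(\gamma_1,p_1,h_1)=(\gamma_2\circ\gamma_1,p_1,h_2h_1)$, unit map $p\mapsto(1_{\pi(p)},p,e_H)$ and inverse map $(\gamma,p,h)\mapsto(\gamma^{-1},\mu(\gamma,p)\,\tau(h^{-1}),h^{-1})$. 2. $\mathbb E^{\rm dec}$ is a principal $\mathbb G$-bundle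 over $\mathbb X$, with action $\mathbb E^{\rm dec}\times\mathbb G\to\mathbb E^{\rm dec}$ given by $(p,g)\mapsto pg$ on objects and $\bigl((\gamma,p,h),(h',g)\bigr)\mapsto\bigl(\gamma,pg,\alpha_{g^{-1}}(h'^{-1}h)\bigr)$ on morphisms, and projection $\mathbb E^{\rm dec}\to\mathbb X$ given by $p\mapsto\pi(p)$ and $(\gamma,p,h)\mapsto\gamma$. That is, action and projection are morphisms of Lie groupoids, $E_G\to X_0$ is a principal $G$-bundle, and $s^*E_G\times H\to X_1$ is a principal $(H\rtimes_\alpha G)$-bundle. -/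

import Mathlib

open scoped Manifold ContDiff

noncomputable section

/-! ### Manifolds, submersions, fibre products -/

section Manifolds

variable {E H M E' H' M' : Type*}
  [NormedAddCommGroup E] [NormedSpace ℝ E] [TopologicalSpace H]
  [TopologicalSpace M] [ChartedSpace H M]
  [NormedAddCommGroup E'] [NormedSpace ℝ E'] [TopologicalSpace H']
  [TopologicalSpace M'] [ChartedSpace H' M']

/-- `M` is a smooth finite-dimensional manifold without boundary, Hausdorff and second countable. -/
structure IsSmoothManifold (I : ModelWithCorners ℝ E H) (M : Type*)
    [TopologicalSpace M] [ChartedSpace H M] : Prop where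
  finiteDimensional : FiniteDimensional ℝ E
  boundaryless : I.Boundaryless
  isManifold : IsManifold I ∞ M
  t2 : T2Space M
  secondCountable : SecondCountableTopology M

/-- Surjective submersions: smooth surjections whose differential is surjective at every point. -/
structure IsSurjectiveSubmersion (I : ModelWithCorners ℝ E H) (I' : ModelWithCorners ℝ E' H')
    (f : M → M') : Prop where
  smooth : ContMDiff I I' ∞ f
  surjective : Function.Surjective f
  mfderiv_surjective : ∀ x, Function.Surjective (mfderiv I I' f x)

/-- Smoothness of a map defined only on a subset `s` of a manifold `M`: it is the restriction of
a map that is smooth on `s` in the sense of `ContMDiffOn`. When `s` is an embedded submanifold this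
is smoothness for the submanifold structure. -/
def SmoothOnSubset (I : ModelWithCorners ℝ E H) (I' : ModelWithCorners ℝ E' H')
    {s : Set M} (f : s → M') : Prop :=
  ∃ F : M → M', ContMDiffOn I I' ∞ F s ∧ ∀ x : s, F x = f x

/-- The fibre product `A ×_{f, C, g} B`, a subset of `A × B`. -/
def fibreProd {A B C : Type*} (f : A → C) (g : B → C) : Set (A × B) :=
  {q | f q.1 = g q.2}

/-- A manifold structure on the subset `s` (with its subspace topology) that makes it an embedded
submanifold of `M`: the inclusion, which is a topological embedding, is a smooth immersion. -/
structure IsEmbeddedSubmanifold (I' : ModelWithCorners ℝ E' H') (I : ModelWithCorners ℝ E H)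
    (s : Set M) [ChartedSpace H' s] : Prop where
  isSmoothManifold : IsSmoothManifold I' s
  smooth_val : ContMDiff I' I ∞ (Subtype.val : s → M)
  mfderiv_val_injective :
    ∀ x : s, Function.Injective (mfderiv I' I (Subtype.val : s → M) x)

theorem IsSmoothManifold.prod {I : ModelWithCorners ℝ E H} {I' : ModelWithCorners ℝ E' H'}
    (h : IsSmoothManifold I M) (h' : IsSmoothManifold I' M') :
    IsSmoothManifold (I.prod I') (M × M') := by
  obtain ⟨_, _, _, _, _⟩ := h
  obtain ⟨_, _, _, _, _⟩ := h'
  exact ⟨inferInstance, inferInstance, inferInstance, inferInstance, inferInstance⟩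

end Manifolds

/-! ### Lie groupoids -/

/-- A Lie groupoid `[X₁ ⇉ X₀]`. The composite `g ∘ f` is `comp ⟨(g, f), _⟩`, defined when
`src g = tgt f`. -/
structure LieGroupoid {E₀ H₀ E₁ H₁ : Type*}
    [NormedAddCommGroup E₀] [NormedSpace ℝ E₀] [TopologicalSpace H₀]
    [NormedAddCommGroup E₁] [NormedSpace ℝ E₁] [TopologicalSpace H₁]
    (I₀ : ModelWithCorners ℝ E₀ H₀) (X₀ : Type*) [TopologicalSpace X₀] [ChartedSpace H₀ X₀]
    (I₁ : ModelWithCorners ℝ E₁ H₁) (X₁ : Type*) [TopologicalSpace X₁] [ChartedSpace H₁ X₁] where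
  src : X₁ → X₀
  tgt : X₁ → X₀
  comp : fibreProd src tgt → X₁
  unit : X₀ → X₁
  inv : X₁ → X₁
  src_comp : ∀ g f (h : src g = tgt f), src (comp ⟨(g, f), h⟩) = src f
  tgt_comp : ∀ g f (h : src g = tgt f), tgt (comp ⟨(g, f), h⟩) = tgt g
  assoc : ∀ k g f (hkg : src k = tgt g) (hgf : src g = tgt f)
    (h₁ : src (comp ⟨(k, g), hkg⟩) = tgt f) (h₂ : src k = tgt (comp ⟨(g, f), hgf⟩)),
    comp ⟨(comp ⟨(k, g), hkg⟩, f), h₁⟩ = comp ⟨(k, comp ⟨(g, f), hgf⟩), h₂⟩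
  src_unit : ∀ x, src (unit x) = x
  tgt_unit : ∀ x, tgt (unit x) = x
  unit_comp : ∀ f (h : src (unit (tgt f)) = tgt f), comp ⟨(unit (tgt f), f), h⟩ = f
  comp_unit : ∀ f (h : src f = tgt (unit (src f))), comp ⟨(f, unit (src f)), h⟩ = f
  src_inv : ∀ f, src (inv f) = tgt f
  tgt_inv : ∀ f, tgt (inv f) = src f
  inv_comp : ∀ f (h : src (inv f) = tgt f), comp ⟨(inv f, f), h⟩ = unit (src f)
  comp_inv : ∀ f (h : src f = tgt (inv f)), comp ⟨(f, inv f), h⟩ = unit (tgt f)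
  manifold_obj : IsSmoothManifold I₀ X₀
  manifold_mor : IsSmoothManifold I₁ X₁
  submersion_src : IsSurjectiveSubmersion I₁ I₀ src
  submersion_tgt : IsSurjectiveSubmersion I₁ I₀ tgt
  smooth_comp : SmoothOnSubset (I₁.prod I₁) I₁ comp
  smooth_unit : ContMDiff I₀ I₁ ∞ unit
  smooth_inv : ContMDiff I₁ I₁ ∞ inv

section Groupoids

variable {E₀ H₀ X₀ E₁ H₁ X₁ E₀' H₀' Y₀ E₁' H₁' Y₁ : Type*}
  [NormedAddCommGroup E₀] [NormedSpace ℝ E₀] [TopologicalSpace H₀]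
  [NormedAddCommGroup E₁] [NormedSpace ℝ E₁] [TopologicalSpace H₁]
  {I₀ : ModelWithCorners ℝ E₀ H₀} [TopologicalSpace X₀] [ChartedSpace H₀ X₀]
  {I₁ : ModelWithCorners ℝ E₁ H₁} [TopologicalSpace X₁] [ChartedSpace H₁ X₁]
  [NormedAddCommGroup E₀'] [NormedSpace ℝ E₀'] [TopologicalSpace H₀']
  [NormedAddCommGroup E₁'] [NormedSpace ℝ E₁'] [TopologicalSpace H₁']
  {J₀ : ModelWithCorners ℝ E₀' H₀'} [TopologicalSpace Y₀] [ChartedSpace H₀' Y₀]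
  {J₁ : ModelWithCorners ℝ E₁' H₁'} [TopologicalSpace Y₁] [ChartedSpace H₁' Y₁]

/-- `(F₀, F₁)` is a morphism of Lie groupoids, i.e. a smooth functor, from `X` to `Y`. -/
structure IsLieGroupoidHom (X : LieGroupoid I₀ X₀ I₁ X₁) (Y : LieGroupoid J₀ Y₀ J₁ Y₁)
    (F₀ : X₀ → Y₀) (F₁ : X₁ → Y₁) : Prop where
  smooth_obj : ContMDiff I₀ J₀ ∞ F₀
  smooth_mor : ContMDiff I₁ J₁ ∞ F₁
  map_src : ∀ f, Y.src (F₁ f) = F₀ (X.src f)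
  map_tgt : ∀ f, Y.tgt (F₁ f) = F₀ (X.tgt f)
  map_unit : ∀ x, F₁ (X.unit x) = Y.unit (F₀ x)
  map_comp : ∀ g f (h : X.src g = X.tgt f) (h' : Y.src (F₁ g) = Y.tgt (F₁ f)),
    F₁ (X.comp ⟨(g, f), h⟩) = Y.comp ⟨(F₁ g, F₁ f), h'⟩

theorem IsSurjectiveSubmersion.prodMap {f : X₁ → X₀} {g : Y₁ → Y₀}
    (hf : IsSurjectiveSubmersion I₁ I₀ f) (hg : IsSurjectiveSubmersion J₁ J₀ g) :
    IsSurjectiveSubmersion (I₁.prod J₁) (I₀.prod J₀) (Prod.map f g) where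
  smooth := hf.smooth.prodMap hg.smooth
  surjective := hf.surjective.prodMap hg.surjective
  mfderiv_surjective := by
    intro p
    rw [mfderiv_prodMap (hf.smooth.mdifferentiable (by simp) p.1)
      (hg.smooth.mdifferentiable (by simp) p.2)]
    rintro ⟨a, b⟩
    obtain ⟨u, rfl⟩ := hf.mfderiv_surjective p.1 a
    obtain ⟨v, rfl⟩ := hg.mfderiv_surjective p.2 b
    exact ⟨(u, v), rfl⟩

/-- The product of two Lie groupoids. -/
def LieGroupoid.prod (X : LieGroupoid I₀ X₀ I₁ X₁) (Y : LieGroupoid J₀ Y₀ J₁ Y₁) :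
    LieGroupoid (I₀.prod J₀) (X₀ × Y₀) (I₁.prod J₁) (X₁ × Y₁) where
  src := Prod.map X.src Y.src
  tgt := Prod.map X.tgt Y.tgt
  comp := fun q =>
    (X.comp ⟨(q.1.1.1, q.1.2.1), congrArg Prod.fst q.2⟩,
      Y.comp ⟨(q.1.1.2, q.1.2.2), congrArg Prod.snd q.2⟩)
  unit := Prod.map X.unit Y.unit
  inv := Prod.map X.inv Y.inv
  src_comp := fun _ _ _ => Prod.ext (X.src_comp _ _ _) (Y.src_comp _ _ _)
  tgt_comp := fun _ _ _ => Prod.ext (X.tgt_comp _ _ _) (Y.tgt_comp _ _ _)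
  assoc := fun _ _ _ _ _ _ _ => Prod.ext (X.assoc _ _ _ _ _ _ _) (Y.assoc _ _ _ _ _ _ _)
  src_unit := fun _ => Prod.ext (X.src_unit _) (Y.src_unit _)
  tgt_unit := fun _ => Prod.ext (X.tgt_unit _) (Y.tgt_unit _)
  unit_comp := fun _ _ => Prod.ext (X.unit_comp _ _) (Y.unit_comp _ _)
  comp_unit := fun _ _ => Prod.ext (X.comp_unit _ _) (Y.comp_unit _ _)
  src_inv := fun _ => Prod.ext (X.src_inv _) (Y.src_inv _)
  tgt_inv := fun _ => Prod.ext (X.tgt_inv _) (Y.tgt_inv _)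
  inv_comp := fun _ _ => Prod.ext (X.inv_comp _ _) (Y.inv_comp _ _)
  comp_inv := fun _ _ => Prod.ext (X.comp_inv _ _) (Y.comp_inv _ _)
  manifold_obj := X.manifold_obj.prod Y.manifold_obj
  manifold_mor := X.manifold_mor.prod Y.manifold_mor
  submersion_src := X.submersion_src.prodMap Y.submersion_src
  submersion_tgt := X.submersion_tgt.prodMap Y.submersion_tgt
  smooth_comp := by
    obtain ⟨F, hF, hF'⟩ := X.smooth_comp
    obtain ⟨K, hK, hK'⟩ := Y.smooth_comp
    refine ⟨fun q => (F (q.1.1, q.2.1), K (q.1.2, q.2.2)), ?_, ?_⟩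
    · refine ContMDiffOn.prodMk
        (hF.comp (f := fun q : (X₁ × Y₁) × X₁ × Y₁ => (q.1.1, q.2.1)) ?_ ?_)
        (hK.comp (f := fun q : (X₁ × Y₁) × X₁ × Y₁ => (q.1.2, q.2.2)) ?_ ?_)
      · exact ((contMDiff_fst.comp contMDiff_fst).prodMk
          (contMDiff_fst.comp contMDiff_snd)).contMDiffOn
      · exact fun q hq => congrArg Prod.fst hq
      · exact ((contMDiff_snd.comp contMDiff_fst).prodMk
          (contMDiff_snd.comp contMDiff_snd)).contMDiffOn
      · exact fun q hq => congrArg Prod.snd hq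
    · exact fun q => Prod.ext (hF' ⟨(q.1.1.1, q.1.2.1), congrArg Prod.fst q.2⟩)
        (hK' ⟨(q.1.1.2, q.1.2.2), congrArg Prod.snd q.2⟩)
  smooth_unit := X.smooth_unit.prodMap Y.smooth_unit
  smooth_inv := X.smooth_inv.prodMap Y.smooth_inv

end Groupoids

/-! ### Lie 2-groups and Lie crossed modules -/

/-- A (strict) Lie 2-group `[G₁ ⇉ G₀]`: a Lie groupoid whose objects and morphisms form Lie groups
such that the multiplication is a morphism of Lie groupoids. (That the structure maps are group
homomorphisms, and that the group inversion is a functor, follows.) -/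
structure LieTwoGroup {E₀ H₀ E₁ H₁ : Type*}
    [NormedAddCommGroup E₀] [NormedSpace ℝ E₀] [TopologicalSpace H₀]
    [NormedAddCommGroup E₁] [NormedSpace ℝ E₁] [TopologicalSpace H₁]
    (I₀ : ModelWithCorners ℝ E₀ H₀) (G₀ : Type*) [TopologicalSpace G₀] [ChartedSpace H₀ G₀]
    [Group G₀]
    (I₁ : ModelWithCorners ℝ E₁ H₁) (G₁ : Type*) [TopologicalSpace G₁] [ChartedSpace H₁ G₁]
    [Group G₁] extends LieGroupoid I₀ G₀ I₁ G₁ where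
  lieGroup_obj : LieGroup I₀ ∞ G₀
  lieGroup_mor : LieGroup I₁ ∞ G₁
  mul_hom : IsLieGroupoidHom (toLieGroupoid.prod toLieGroupoid) toLieGroupoid
    (fun p : G₀ × G₀ => p.1 * p.2) (fun p : G₁ × G₁ => p.1 * p.2)

/-- A Lie crossed module `(G, H, τ, α)`; `α g` is written for the automorphism `α(g, ·)` of `H`. -/
structure LieCrossedModule {EG HG EH HH : Type*}
    [NormedAddCommGroup EG] [NormedSpace ℝ EG] [TopologicalSpace HG]
    [NormedAddCommGroup EH] [NormedSpace ℝ EH] [TopologicalSpace HH]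
    (IG : ModelWithCorners ℝ EG HG) (G : Type*) [TopologicalSpace G] [ChartedSpace HG G] [Group G]
    (IH : ModelWithCorners ℝ EH HH) (H : Type*) [TopologicalSpace H] [ChartedSpace HH H]
    [Group H] where
  manifold_G : IsSmoothManifold IG G
  manifold_H : IsSmoothManifold IH H
  lieGroup_G : LieGroup IG ∞ G
  lieGroup_H : LieGroup IH ∞ H
  τ : H →* G
  smooth_τ : ContMDiff IH IG ∞ τ
  α : G →* MulAut H
  smooth_α : ContMDiff (IG.prod IH) IH ∞ (fun p : G × H => α p.1 p.2)
  τ_α : ∀ g h, τ (α g h) = g * τ h * g⁻¹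
  α_τ : ∀ h h', α (τ h) h' = h * h' * h⁻¹

namespace LieCrossedModule

variable {EG HG G EH HH H : Type*}
  [NormedAddCommGroup EG] [NormedSpace ℝ EG] [TopologicalSpace HG]
  [NormedAddCommGroup EH] [NormedSpace ℝ EH] [TopologicalSpace HH]
  {IG : ModelWithCorners ℝ EG HG} [TopologicalSpace G] [ChartedSpace HG G] [Group G]
  {IH : ModelWithCorners ℝ EH HH} [TopologicalSpace H] [ChartedSpace HH H] [Group H]

/-- The semidirect product `H ⋊_α G`: the manifold `H × G` with the multiplication
`(h₂, g₂) (h₁, g₁) = (h₂ α(g₂, h₁), g₂ g₁)`. -/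
def Mor (_C : LieCrossedModule IG G IH H) : Type _ := H × G

variable (C : LieCrossedModule IG G IH H)

instance : TopologicalSpace C.Mor := inferInstanceAs (TopologicalSpace (H × G))

instance : ChartedSpace (ModelProd HH HG) C.Mor :=
  inferInstanceAs (ChartedSpace (ModelProd HH HG) (H × G))

instance : Group C.Mor where
  mul a b := (a.1 * C.α a.2 b.1, a.2 * b.2)
  one := ((1 : H), (1 : G))
  inv a := (C.α a.2⁻¹ a.1⁻¹, a.2⁻¹)
  mul_assoc a b c := Prod.ext
    (show a.1 * C.α a.2 b.1 * C.α (a.2 * b.2) c.1 = a.1 * C.α a.2 (b.1 * C.α b.2 c.1) by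
      simp [mul_assoc])
    (mul_assoc a.2 b.2 c.2)
  one_mul a := Prod.ext (show 1 * C.α 1 a.1 = a.1 by simp) (one_mul a.2)
  mul_one a := Prod.ext (show a.1 * C.α a.2 1 = a.1 by simp) (mul_one a.2)
  inv_mul_cancel a := Prod.ext
    (show C.α a.2⁻¹ a.1⁻¹ * C.α a.2⁻¹ a.1 = 1 by rw [← map_mul]; simp)
    (inv_mul_cancel a.2)

theorem mul_def (a b : C.Mor) : a * b = ((a.1 * C.α a.2 b.1, a.2 * b.2) : H × G) := rfl

theorem lieGroup_mor : LieGroup (IH.prod IG) ∞ C.Mor := by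
  have := C.lieGroup_G
  have := C.lieGroup_H
  have hα : ContMDiff (IG.prod IH) IH ∞ (fun p : G × H => C.α p.1 p.2) := C.smooth_α
  have hM : IsManifold (IH.prod IG) ∞ C.Mor :=
    inferInstanceAs (IsManifold (IH.prod IG) ∞ (H × G))
  have h1 : ContMDiff ((IH.prod IG).prod (IH.prod IG)) (IH.prod IG) ∞
      (fun p : (H × G) × (H × G) => ((p.1.1 * C.α p.1.2 p.2.1, p.1.2 * p.2.2) : H × G)) := by
    refine ContMDiff.prodMk (ContMDiff.mul (contMDiff_fst.comp contMDiff_fst)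
      (hα.comp (f := fun p : (H × G) × (H × G) => (p.1.2, p.2.1)) ?_))
      (ContMDiff.mul (contMDiff_snd.comp contMDiff_fst) (contMDiff_snd.comp contMDiff_snd))
    exact (contMDiff_snd.comp contMDiff_fst).prodMk (contMDiff_fst.comp contMDiff_snd)
  have h2 : ContMDiff (IH.prod IG) (IH.prod IG) ∞
      (fun a : H × G => ((C.α a.2⁻¹ a.1⁻¹, a.2⁻¹) : H × G)) := by
    refine ContMDiff.prodMk (hα.comp (f := fun a : H × G => (a.2⁻¹, a.1⁻¹)) ?_)
      (ContMDiff.inv contMDiff_snd)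
    exact (ContMDiff.inv contMDiff_snd).prodMk (ContMDiff.inv contMDiff_fst)
  exact { hM with contMDiff_mul := h1, contMDiff_inv := h2 }

set_option linter.unusedSectionVars false in
theorem submersion_src : IsSurjectiveSubmersion (IH.prod IG) IG (fun a : H × G => a.2) where
  smooth := contMDiff_snd
  surjective := Prod.snd_surjective
  mfderiv_surjective := by
    intro a
    have : mfderiv (IH.prod IG) IG (fun a : H × G => a.2) a = _ := mfderiv_snd
    rw [this]
    exact fun v => ⟨(0, v), rfl⟩

theorem submersion_tgt :
    IsSurjectiveSubmersion (IH.prod IG) IG (fun a : H × G => C.τ a.1 * a.2) := by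
  have := C.lieGroup_G
  have hs : ContMDiff (IH.prod IG) IG ∞ (fun a : H × G => C.τ a.1 * a.2) :=
    ContMDiff.mul (C.smooth_τ.comp contMDiff_fst) contMDiff_snd
  refine ⟨hs, fun g => ⟨(1, g), by simp⟩, ?_⟩
  rintro ⟨h, g⟩
  obtain ⟨x, rfl⟩ : ∃ x, g = (C.τ h)⁻¹ * x := ⟨C.τ h * g, by simp⟩
  have hsec : ContMDiff IG (IH.prod IG) ∞ (fun x : G => (h, (C.τ h)⁻¹ * x)) :=
    contMDiff_const.prodMk (ContMDiff.mul contMDiff_const contMDiff_id)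
  have hcomp : (fun a : H × G => C.τ a.1 * a.2) ∘ (fun x : G => (h, (C.τ h)⁻¹ * x)) = id := by
    funext x; simp
  have hd := mfderiv_comp (I := IG) (I' := IH.prod IG) (I'' := IG) x
    (hs.mdifferentiable (by simp) (h, (C.τ h)⁻¹ * x)) (hsec.mdifferentiable (by simp) x)
  rw [hcomp, mfderiv_id] at hd
  intro v
  exact ⟨mfderiv IG (IH.prod IG) (fun x : G => (h, (C.τ h)⁻¹ * x)) x v,
    (DFunLike.congr_fun hd v).symm⟩

/-- The Lie groupoid `[H ⋊_α G ⇉ G]` of a Lie crossed module. -/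
def toLieGroupoid : LieGroupoid IG G (IH.prod IG) C.Mor where
  src := fun a => a.2
  tgt := fun a => C.τ a.1 * a.2
  comp := fun q => ((q.1.1.1 * q.1.2.1, q.1.2.2) : H × G)
  unit := fun g => ((1, g) : H × G)
  inv := fun a => ((a.1⁻¹, C.τ a.1 * a.2) : H × G)
  src_comp := fun _ _ _ => rfl
  tgt_comp := by
    rintro ⟨h₂, g₂⟩ ⟨h₁, g₁⟩ h
    dsimp only at h
    subst h
    simp [mul_assoc]
  assoc := fun _ _ _ _ _ _ _ => Prod.ext (mul_assoc _ _ _) rfl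
  src_unit := fun _ => rfl
  tgt_unit := fun x => by simp
  unit_comp := fun f _ => Prod.ext (one_mul f.1) rfl
  comp_unit := fun f _ => Prod.ext (mul_one f.1) rfl
  src_inv := fun _ => rfl
  tgt_inv := fun f => by simp
  inv_comp := fun f _ => Prod.ext (inv_mul_cancel f.1) rfl
  comp_inv := fun f _ => Prod.ext (mul_inv_cancel f.1) rfl
  manifold_obj := C.manifold_G
  manifold_mor := C.manifold_H.prod C.manifold_G
  submersion_src := submersion_src
  submersion_tgt := C.submersion_tgt
  smooth_comp := by
    have := C.lieGroup_H
    have h : ContMDiff ((IH.prod IG).prod (IH.prod IG)) (IH.prod IG) ∞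
        (fun q : (H × G) × (H × G) => ((q.1.1 * q.2.1, q.2.2) : H × G)) :=
      ContMDiff.prodMk
        (ContMDiff.mul (contMDiff_fst.comp contMDiff_fst) (contMDiff_fst.comp contMDiff_snd))
        (contMDiff_snd.comp contMDiff_snd)
    exact ⟨fun q : (H × G) × (H × G) => ((q.1.1 * q.2.1, q.2.2) : H × G),
      ContMDiff.contMDiffOn h, fun _ => rfl⟩
  smooth_unit := by
    have h : ContMDiff IG (IH.prod IG) ∞ (fun g : G => ((1, g) : H × G)) :=
      contMDiff_const.prodMk contMDiff_id
    exact h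
  smooth_inv := by
    have := C.lieGroup_H
    have h : ContMDiff (IH.prod IG) (IH.prod IG) ∞
        (fun a : H × G => ((a.1⁻¹, C.τ a.1 * a.2) : H × G)) :=
      (ContMDiff.inv contMDiff_fst).prodMk C.submersion_tgt.smooth
    exact h

/-- The Lie 2-group `[H ⋊_α G ⇉ G]` associated to a Lie crossed module. -/
def toLieTwoGroup : LieTwoGroup IG G (IH.prod IG) C.Mor where
  toLieGroupoid := C.toLieGroupoid
  lieGroup_obj := C.lieGroup_G
  lieGroup_mor := C.lieGroup_mor
  mul_hom :=
    { smooth_obj := by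
        have := C.lieGroup_G
        exact contMDiff_mul IG ∞
      smooth_mor := by
        have := C.lieGroup_mor
        exact contMDiff_mul (IH.prod IG) ∞
      map_src := fun _ => rfl
      map_tgt := by
        rintro ⟨⟨h₂, g₂⟩, ⟨h₁, g₁⟩⟩
        change C.τ (h₂ * C.α g₂ h₁) * (g₂ * g₁) = C.τ h₂ * g₂ * (C.τ h₁ * g₁)
        simp [C.τ_α, mul_assoc]
      map_unit := by
        rintro ⟨g₂, g₁⟩
        exact Prod.ext (show 1 * C.α g₂ 1 = 1 by simp) rfl
      map_comp := by
        rintro ⟨⟨k₂, a₂⟩, ⟨k₁, a₁⟩⟩ ⟨⟨h₂, b₂⟩, ⟨h₁, b₁⟩⟩ h h'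
        have e : a₂ = C.τ h₂ * b₂ := congrArg Prod.fst h
        refine Prod.ext ?_ rfl
        change k₂ * h₂ * C.α b₂ (k₁ * h₁) = k₂ * C.α a₂ k₁ * (h₂ * C.α b₂ h₁)
        rw [e, map_mul C.α, MulAut.mul_apply, C.α_τ]
        simp [mul_assoc] }

end LieCrossedModule

/-! ### Principal bundles -/

/-- `proj : P → M`, with the right action `act` of the Lie group `G` on `P`, is a smooth principal
`G`-bundle over `M`: there are `G`-equivariant local trivializations `π⁻¹(U) ≅ U × G` over `M`. -/
structure IsPrincipalBundle {EG HG EP HP EM HM G P M : Type*}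
    [NormedAddCommGroup EG] [NormedSpace ℝ EG] [TopologicalSpace HG]
    [NormedAddCommGroup EP] [NormedSpace ℝ EP] [TopologicalSpace HP]
    [NormedAddCommGroup EM] [NormedSpace ℝ EM] [TopologicalSpace HM]
    (IG : ModelWithCorners ℝ EG HG) [TopologicalSpace G] [ChartedSpace HG G] [Group G]
    (IP : ModelWithCorners ℝ EP HP) [TopologicalSpace P] [ChartedSpace HP P]
    (IM : ModelWithCorners ℝ EM HM) [TopologicalSpace M] [ChartedSpace HM M]
    (proj : P → M) (act : P → G → P) : Prop where
  manifold_group : IsSmoothManifold IG G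
  lieGroup : LieGroup IG ∞ G
  manifold_total : IsSmoothManifold IP P
  manifold_base : IsSmoothManifold IM M
  act_one : ∀ p, act p 1 = p
  act_mul : ∀ p g g', act p (g * g') = act (act p g) g'
  smooth_act : ContMDiff (IP.prod IG) IP ∞ (fun q : P × G => act q.1 q.2)
  smooth_proj : ContMDiff IP IM ∞ proj
  proj_act : ∀ p g, proj (act p g) = proj p
  locally_trivial : ∀ x : M, ∃ U : Set M, IsOpen U ∧ x ∈ U ∧
    ∃ φ : OpenPartialHomeomorph P (M × G),
      φ.source = proj ⁻¹' U ∧ φ.target = U ×ˢ Set.univ ∧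
      ContMDiffOn IP (IM.prod IG) ∞ φ φ.source ∧
      ContMDiffOn (IM.prod IG) IP ∞ φ.symm φ.target ∧
      (∀ p ∈ φ.source, (φ p).1 = proj p) ∧
      ∀ p ∈ φ.source, ∀ g, (φ (act p g)).2 = (φ p).2 * g

/-- A principal `G`-bundle over a Lie groupoid `X = [X₁ ⇉ X₀]`: a principal `G`-bundle
`proj : P → X₀` with a smooth action `μ : X₁ ×_{s, X₀, π} P → P` of the groupoid that commutes
with the action of `G`. -/
structure PrincipalBundleOver {E₀ H₀ X₀ E₁ H₁ X₁ EG HG EP HP : Type*}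
    [NormedAddCommGroup E₀] [NormedSpace ℝ E₀] [TopologicalSpace H₀]
    [NormedAddCommGroup E₁] [NormedSpace ℝ E₁] [TopologicalSpace H₁]
    {I₀ : ModelWithCorners ℝ E₀ H₀} [TopologicalSpace X₀] [ChartedSpace H₀ X₀]
    {I₁ : ModelWithCorners ℝ E₁ H₁} [TopologicalSpace X₁] [ChartedSpace H₁ X₁]
    (X : LieGroupoid I₀ X₀ I₁ X₁)
    [NormedAddCommGroup EG] [NormedSpace ℝ EG] [TopologicalSpace HG]
    [NormedAddCommGroup EP] [NormedSpace ℝ EP] [TopologicalSpace HP]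
    (IG : ModelWithCorners ℝ EG HG) (G : Type*) [TopologicalSpace G] [ChartedSpace HG G] [Group G]
    (IP : ModelWithCorners ℝ EP HP) (P : Type*) [TopologicalSpace P] [ChartedSpace HP P] where
  proj : P → X₀
  act : P → G → P
  isPrincipalBundle : IsPrincipalBundle IG IP I₀ proj act
  μ : fibreProd X.src proj → P
  smooth_μ : SmoothOnSubset (I₁.prod IP) IP μ
  μ_unit : ∀ p (h : X.src (X.unit (proj p)) = proj p), μ ⟨(X.unit (proj p), p), h⟩ = p
  proj_μ : ∀ γ p (h : X.src γ = proj p), proj (μ ⟨(γ, p), h⟩) = X.tgt γ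
  μ_comp : ∀ γ₂ γ₁ p (h : X.src γ₂ = X.tgt γ₁) (h₁ : X.src γ₁ = proj p)
    (h₂ : X.src (X.comp ⟨(γ₂, γ₁), h⟩) = proj p) (h₃ : X.src γ₂ = proj (μ ⟨(γ₁, p), h₁⟩)),
    μ ⟨(X.comp ⟨(γ₂, γ₁), h⟩, p), h₂⟩ = μ ⟨(γ₂, μ ⟨(γ₁, p), h₁⟩), h₃⟩
  μ_act : ∀ γ p g (h : X.src γ = proj p) (h' : X.src γ = proj (act p g)),
    act (μ ⟨(γ, p), h⟩) g = μ ⟨(γ, act p g), h'⟩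

/-- `(π₀, π₁) : 𝔼 → X` with the right action `(ρ₀, ρ₁) : 𝔼 × 𝔾 → 𝔼` is a principal `𝔾`-bundle over
the Lie groupoid `X`: both are morphisms of Lie groupoids, and on objects and on morphisms they are
principal bundles (in particular `ρ₀` and `ρ₁` are right actions of Lie groups). -/
structure IsPrincipalTwoBundle {E₀ H₀ X₀ E₁ H₁ X₁ EA HA A₀ EB HB A₁ EG HG G₀ EK HK G₁ : Type*}
    [NormedAddCommGroup E₀] [NormedSpace ℝ E₀] [TopologicalSpace H₀]
    [NormedAddCommGroup E₁] [NormedSpace ℝ E₁] [TopologicalSpace H₁]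
    {I₀ : ModelWithCorners ℝ E₀ H₀} [TopologicalSpace X₀] [ChartedSpace H₀ X₀]
    {I₁ : ModelWithCorners ℝ E₁ H₁} [TopologicalSpace X₁] [ChartedSpace H₁ X₁]
    [NormedAddCommGroup EA] [NormedSpace ℝ EA] [TopologicalSpace HA]
    [NormedAddCommGroup EB] [NormedSpace ℝ EB] [TopologicalSpace HB]
    {IA : ModelWithCorners ℝ EA HA} [TopologicalSpace A₀] [ChartedSpace HA A₀]
    {IB : ModelWithCorners ℝ EB HB} [TopologicalSpace A₁] [ChartedSpace HB A₁]
    [NormedAddCommGroup EG] [NormedSpace ℝ EG] [TopologicalSpace HG]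
    [NormedAddCommGroup EK] [NormedSpace ℝ EK] [TopologicalSpace HK]
    {IG : ModelWithCorners ℝ EG HG} [TopologicalSpace G₀] [ChartedSpace HG G₀] [Group G₀]
    {IK : ModelWithCorners ℝ EK HK} [TopologicalSpace G₁] [ChartedSpace HK G₁] [Group G₁]
    (𝔾 : LieTwoGroup IG G₀ IK G₁) (𝔼 : LieGroupoid IA A₀ IB A₁) (X : LieGroupoid I₀ X₀ I₁ X₁)
    (π₀ : A₀ → X₀) (π₁ : A₁ → X₁) (ρ₀ : A₀ → G₀ → A₀) (ρ₁ : A₁ → G₁ → A₁) : Prop where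
  proj_hom : IsLieGroupoidHom 𝔼 X π₀ π₁
  act_hom : IsLieGroupoidHom (𝔼.prod 𝔾.toLieGroupoid) 𝔼
    (fun q : A₀ × G₀ => ρ₀ q.1 q.2) (fun q : A₁ × G₁ => ρ₁ q.1 q.2)
  principal_obj : IsPrincipalBundle IG IA I₀ π₀ ρ₀
  principal_mor : IsPrincipalBundle IK IB I₁ π₁ ρ₁

/-! ### The decorated groupoid -/

namespace PrincipalBundleOver

variable {E₀ H₀ X₀ E₁ H₁ X₁ EG HG G EH HH H EP HP P : Type*}
  [NormedAddCommGroup E₀] [NormedSpace ℝ E₀] [TopologicalSpace H₀]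
  [NormedAddCommGroup E₁] [NormedSpace ℝ E₁] [TopologicalSpace H₁]
  {I₀ : ModelWithCorners ℝ E₀ H₀} [TopologicalSpace X₀] [ChartedSpace H₀ X₀]
  {I₁ : ModelWithCorners ℝ E₁ H₁} [TopologicalSpace X₁] [ChartedSpace H₁ X₁]
  {X : LieGroupoid I₀ X₀ I₁ X₁}
  [NormedAddCommGroup EG] [NormedSpace ℝ EG] [TopologicalSpace HG]
  [NormedAddCommGroup EH] [NormedSpace ℝ EH] [TopologicalSpace HH]
  [NormedAddCommGroup EP] [NormedSpace ℝ EP] [TopologicalSpace HP]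
  {IG : ModelWithCorners ℝ EG HG} [TopologicalSpace G] [ChartedSpace HG G] [Group G]
  {IH : ModelWithCorners ℝ EH HH} [TopologicalSpace H] [ChartedSpace HH H] [Group H]
  {IP : ModelWithCorners ℝ EP HP} [TopologicalSpace P] [ChartedSpace HP P]

/-- The pullback `s^* P = X₁ ×_{s, X₀, π} P`. -/
abbrev pullback (B : PrincipalBundleOver X IG G IP P) : Set (X₁ × P) := fibreProd X.src B.proj

variable (B : PrincipalBundleOver X IG G IP P) (C : LieCrossedModule IG G IH H)

/-- `(γ, p, h) ↦ p` -/
def decSrc (a : B.pullback × H) : P := a.1.1.2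

/-- `(γ, p, h) ↦ μ(γ, p) τ(h⁻¹)` -/
def decTgt (a : B.pullback × H) : P := B.act (B.μ a.1) (C.τ a.2⁻¹)

theorem proj_decTgt (a : B.pullback × H) : B.proj (B.decTgt C a) = X.tgt a.1.1.1 :=
  (B.isPrincipalBundle.proj_act _ _).trans (B.proj_μ _ _ _)

theorem src_eq_tgt {b a : B.pullback × H} (h : B.decSrc b = B.decTgt C a) :
    X.src b.1.1.1 = X.tgt a.1.1.1 :=
  (b.1.2.trans (congrArg B.proj h)).trans (B.proj_decTgt C a)

/-- `((γ₂, p₂, h₂), (γ₁, p₁, h₁)) ↦ (γ₂ ∘ γ₁, p₁, h₂ h₁)` -/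
def decComp (q : fibreProd (B.decSrc (H := H)) (B.decTgt C)) : B.pullback × H :=
  (⟨(X.comp ⟨(q.1.1.1.1.1, q.1.2.1.1.1), B.src_eq_tgt C q.2⟩, q.1.2.1.1.2),
    (X.src_comp _ _ _).trans q.1.2.1.2⟩, q.1.1.2 * q.1.2.2)

/-- `p ↦ (1_{π(p)}, p, e)` -/
def decUnit (p : P) : B.pullback × H := (⟨(X.unit (B.proj p), p), X.src_unit _⟩, 1)

/-- `(γ, p, h) ↦ (γ⁻¹, μ(γ, p) τ(h⁻¹), h⁻¹)` -/
def decInv (a : B.pullback × H) : B.pullback × H :=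
  (⟨(X.inv a.1.1.1, B.decTgt C a), (X.src_inv _).trans (B.proj_decTgt C a).symm⟩, a.2⁻¹)

/-- `(γ, p, h) ↦ γ` -/
def decProj (a : B.pullback × H) : X₁ := a.1.1.1

/-- `((γ, p, h), (h', g)) ↦ (γ, p g, α_{g⁻¹}(h'⁻¹ h))` -/
def decAct (a : B.pullback × H) (k : C.Mor) : B.pullback × H :=
  (⟨(a.1.1.1, B.act a.1.1.2 k.2), a.1.2.trans (B.isPrincipalBundle.proj_act _ _).symm⟩,
    C.α k.2⁻¹ (k.1⁻¹ * a.2))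

end PrincipalBundleOver

end

/-! The pullback `s^* P` needs no transversality argument, because local triviality of `P` already
supplies its charts. If `φ` trivializes `P` over `U`, then `(γ, p) ↦ (γ, pr₂ φ(p))` identifies the
part of `s^* P` over `s⁻¹(U)` with `s⁻¹(U) × G`, with inverse `(γ, g) ↦ (γ, φ⁻¹(s(γ), g))`. Two such
identifications differ by a smooth map, so composing them with charts of `X₁ × G` gives an atlas
(`contMDiffOn_pullbackTriv_trans`). The same formulas provide smooth local retractions of `X₁ × P`
onto `s^* P`. Hence the inclusion is an immersion, and a map into `s^* P` is smooth as soon as it is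
smooth into `X₁ × P` (`contMDiffOn_pullback`). Smoothness of every structure map follows from the
latter.

The groupoid axioms are those of `X` and of the group `H`, except for those involving the target.
These hold because `μ` commutes with the right `G`-action, so that the factors `τ(h⁻¹)` can be
collected on the right (`decTgt_decComp`, `decTgt_decInv`). In local trivializations the source is
`s × id`, hence a submersion, and the target is the source composed with the inversion, a
diffeomorphism.

For the 2-group action, equivariance of `τ` makes the action respect targets, and the Peiffer
identity makes it respect composition. Over `s⁻¹(U)` the bundle `s^* P × H → X₁` is trivialized by
`(γ, p, h) ↦ (γ, (α_g(h)⁻¹, g))` with `g = pr₂ φ(p)` (`decTriv`). -/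

noncomputable section

/-! ### Manifold structures from partial homeomorphisms to a manifold -/

section ChartsInManifold

variable {E H N Q : Type*} [NormedAddCommGroup E] [NormedSpace ℝ E] [TopologicalSpace H]
  [TopologicalSpace N] [ChartedSpace H N] [TopologicalSpace Q]

/-- The charted space structure on `Q` given by partial homeomorphisms of `Q` to a charted space
`N`, composed with the charts of `N`. -/
@[reducible]
def chartedSpaceOfCover (H : Type*) [TopologicalSpace H] [ChartedSpace H N]
    (ψ : Q → OpenPartialHomeomorph Q N) (hψ : ∀ q, q ∈ (ψ q).source) : ChartedSpace H Q where
  atlas := {e | ∃ q, ∃ c ∈ atlas H N, e = ψ q ≫ₕ c}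
  chartAt q := ψ q ≫ₕ chartAt H (ψ q q)
  mem_chart_source q := by simp [hψ q]
  chart_mem_atlas q := ⟨q, _, chart_mem_atlas H _, rfl⟩

variable {I : ModelWithCorners ℝ E H} [IsManifold I ∞ N]
  {ψ : Q → OpenPartialHomeomorph Q N} {hψ : ∀ q, q ∈ (ψ q).source}

/-- A coordinate change of `Q` is a transition map between two `ψ`'s, sandwiched between charts of
`N`, which are smooth in both directions. -/
theorem isManifold_chartedSpaceOfCover
    (h : ∀ q q', ContMDiffOn I I ∞ ((ψ q).symm ≫ₕ ψ q') ((ψ q).symm ≫ₕ ψ q').source) :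
    letI := chartedSpaceOfCover H ψ hψ
    IsManifold I ∞ Q := by
  let _ := chartedSpaceOfCover H ψ hψ
  refine isManifold_of_contDiffOn I ∞ Q ?_
  rintro _ _ ⟨q, c, hc, rfl⟩ ⟨q', c', hc', rfl⟩
  rw [← contMDiffOn_iff_contDiffOn]
  have hc1 : ContMDiffOn I I ∞ c.symm c.target :=
    contMDiffOn_symm_of_mem_maximalAtlas (IsManifold.subset_maximalAtlas hc)
  have hc2 : ContMDiffOn I I ∞ c' c'.source :=
    contMDiffOn_of_mem_maximalAtlas (IsManifold.subset_maximalAtlas hc')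
  have h1 := (h q q').comp (hc1.comp ((I.contMDiffOn_symm (n := ∞)).mono
    Set.inter_subset_left) (fun x hx => hx.2)
    |>.mono Set.inter_subset_left) (fun x hx => hx.2)
  have h2 := (I.contMDiff (n := ∞)).comp_contMDiffOn
    (hc2.comp (h1.mono Set.inter_subset_left) (fun x hx => hx.2))
  refine h2.mono ?_
  rintro x ⟨hx, hr⟩
  simp only [mfld_simps] at hx hr ⊢
  tauto

/-- Near `x` one has `ψ q = c⁻¹ ∘ (ψ q ≫ₕ c)` for the chart `c` of `N` at `ψ q x`. The second factor
is a chart of `Q` because the atlas admits every chart of `N` after `ψ q`, not only the one at `ψ q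
q`. -/
theorem contMDiffOn_cover
    (h : ∀ q q', ContMDiffOn I I ∞ ((ψ q).symm ≫ₕ ψ q') ((ψ q).symm ≫ₕ ψ q').source) (q : Q) :
    letI := chartedSpaceOfCover H ψ hψ
    ContMDiffOn I I ∞ (ψ q) (ψ q).source := by
  let _ := chartedSpaceOfCover H ψ hψ
  have : IsManifold I ∞ Q := isManifold_chartedSpaceOfCover h
  intro x hx
  refine ContMDiffAt.contMDiffWithinAt ?_
  let c := chartAt H (ψ q x)
  have hmem : ψ q ≫ₕ c ∈ IsManifold.maximalAtlas I ∞ Q :=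
    IsManifold.subset_maximalAtlas ⟨q, c, chart_mem_atlas H _, rfl⟩
  have hxs : x ∈ (ψ q ≫ₕ c).source := by simp [hx, c]
  have h1 : ContMDiffAt I I ∞ (ψ q ≫ₕ c) x := contMDiffAt_of_mem_maximalAtlas hmem hxs
  have h2 : ContMDiffAt I I ∞ c.symm ((ψ q ≫ₕ c) x) :=
    contMDiffAt_symm_of_mem_maximalAtlas (IsManifold.chart_mem_maximalAtlas _) (by simp [c])
  refine (h2.comp x h1).congr_of_eventuallyEq ?_
  filter_upwards [(ψ q ≫ₕ c).open_source.mem_nhds hxs] with y hy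
  exact (c.left_inv hy.2).symm

theorem contMDiffOn_cover_symm
    (h : ∀ q q', ContMDiffOn I I ∞ ((ψ q).symm ≫ₕ ψ q') ((ψ q).symm ≫ₕ ψ q').source) (q : Q) :
    letI := chartedSpaceOfCover H ψ hψ
    ContMDiffOn I I ∞ (ψ q).symm (ψ q).target := by
  let _ := chartedSpaceOfCover H ψ hψ
  have : IsManifold I ∞ Q := isManifold_chartedSpaceOfCover h
  intro x hx
  refine ContMDiffAt.contMDiffWithinAt ?_
  let c := chartAt H x
  have hmem : ψ q ≫ₕ c ∈ IsManifold.maximalAtlas I ∞ Q :=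
    IsManifold.subset_maximalAtlas ⟨q, c, chart_mem_atlas H _, rfl⟩
  have h1 : ContMDiffAt I I ∞ c x :=
    contMDiffAt_of_mem_maximalAtlas (IsManifold.chart_mem_maximalAtlas _) (by simp [c])
  have h2 : ContMDiffAt I I ∞ (ψ q ≫ₕ c).symm (c x) :=
    contMDiffAt_symm_of_mem_maximalAtlas hmem (by simp [c, hx])
  refine (h2.comp x h1).congr_of_eventuallyEq ?_
  filter_upwards [c.open_source.mem_nhds (mem_chart_source H x)] with y hy
  exact congrArg (ψ q).symm (c.left_inv hy).symm

end ChartsInManifold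

/-! ### Differentials of local left inverses and of composites -/

section Derivatives

variable {E H M E' H' M' : Type*}
  [NormedAddCommGroup E] [NormedSpace ℝ E] [TopologicalSpace H]
  [TopologicalSpace M] [ChartedSpace H M]
  [NormedAddCommGroup E'] [NormedSpace ℝ E'] [TopologicalSpace H']
  [TopologicalSpace M'] [ChartedSpace H' M']
  {I : ModelWithCorners ℝ E H} {I' : ModelWithCorners ℝ E' H'}

-- Chain rule for `g ∘ f = id` near `x`. It is used in both directions: `df` is injective
-- (immersions), and `dg` is surjective (submersions).
open scoped Topology in
theorem mfderiv_comp_of_eventually_leftInverse {f : M → M'} {g : M' → M} {x : M}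
    (hf : MDifferentiableAt I I' f x) (hg : MDifferentiableAt I' I g (f x))
    (h : ∀ᶠ y in 𝓝 x, g (f y) = y) (v : TangentSpace I x) :
    mfderiv I' I g (f x) (mfderiv I I' f x v) = v := by
  have h1 := mfderiv_comp x hg hf
  rw [Filter.EventuallyEq.mfderiv_eq (show g ∘ f =ᶠ[𝓝 x] id from h), mfderiv_id] at h1
  exact (DFunLike.congr_fun h1 v).symm

theorem mfderiv_surjective_of_comp {E'' H'' M'' : Type*}
    [NormedAddCommGroup E''] [NormedSpace ℝ E''] [TopologicalSpace H'']
    [TopologicalSpace M''] [ChartedSpace H'' M''] {I'' : ModelWithCorners ℝ E'' H''}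
    {f : M → M'} {g : M' → M''} {x : M} (hf : MDifferentiableAt I I' f x)
    (hg : MDifferentiableAt I' I'' g (f x))
    (h : Function.Surjective (mfderiv I I'' (g ∘ f) x)) :
    Function.Surjective (mfderiv I' I'' g (f x)) := by
  rw [mfderiv_comp x hg hf] at h
  exact Function.Surjective.of_comp (g := mfderiv I I' f x) h

end Derivatives

/-! ### The pullback of a principal bundle along the source map -/

namespace PrincipalBundleOver

variable {E₀ H₀ X₀ E₁ H₁ X₁ EG HG G EH HH H EP HP P EM HM M : Type*}
  [NormedAddCommGroup E₀] [NormedSpace ℝ E₀] [TopologicalSpace H₀]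
  [NormedAddCommGroup E₁] [NormedSpace ℝ E₁] [TopologicalSpace H₁]
  {I₀ : ModelWithCorners ℝ E₀ H₀} [TopologicalSpace X₀] [ChartedSpace H₀ X₀]
  {I₁ : ModelWithCorners ℝ E₁ H₁} [TopologicalSpace X₁] [ChartedSpace H₁ X₁]
  {X : LieGroupoid I₀ X₀ I₁ X₁}
  [NormedAddCommGroup EG] [NormedSpace ℝ EG] [TopologicalSpace HG]
  [NormedAddCommGroup EH] [NormedSpace ℝ EH] [TopologicalSpace HH]
  [NormedAddCommGroup EP] [NormedSpace ℝ EP] [TopologicalSpace HP]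
  [NormedAddCommGroup EM] [NormedSpace ℝ EM] [TopologicalSpace HM]
  {IG : ModelWithCorners ℝ EG HG} [TopologicalSpace G] [ChartedSpace HG G] [Group G]
  {IH : ModelWithCorners ℝ EH HH} [TopologicalSpace H] [ChartedSpace HH H] [Group H]
  {IP : ModelWithCorners ℝ EP HP} [TopologicalSpace P] [ChartedSpace HP P]
  {IM : ModelWithCorners ℝ EM HM} [TopologicalSpace M] [ChartedSpace HM M]
  (B : PrincipalBundleOver X IG G IP P)

/-- A trivializing open neighbourhood of `x`. -/
def trivSet (x : X₀) : Set X₀ := (B.isPrincipalBundle.locally_trivial x).choose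

theorem isOpen_trivSet (x : X₀) : IsOpen (B.trivSet x) :=
  (B.isPrincipalBundle.locally_trivial x).choose_spec.1

theorem mem_trivSet (x : X₀) : x ∈ B.trivSet x :=
  (B.isPrincipalBundle.locally_trivial x).choose_spec.2.1

/-- An equivariant local trivialization over `B.trivSet x`. -/
def triv (x : X₀) : OpenPartialHomeomorph P (X₀ × G) :=
  (B.isPrincipalBundle.locally_trivial x).choose_spec.2.2.choose

theorem triv_spec (x : X₀) :
    (B.triv x).source = B.proj ⁻¹' B.trivSet x ∧ (B.triv x).target = B.trivSet x ×ˢ Set.univ ∧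
      ContMDiffOn IP (I₀.prod IG) ∞ (B.triv x) (B.triv x).source ∧
      ContMDiffOn (I₀.prod IG) IP ∞ (B.triv x).symm (B.triv x).target ∧
      (∀ p ∈ (B.triv x).source, (B.triv x p).1 = B.proj p) ∧
      ∀ p ∈ (B.triv x).source, ∀ g, (B.triv x (B.act p g)).2 = (B.triv x p).2 * g :=
  (B.isPrincipalBundle.locally_trivial x).choose_spec.2.2.choose_spec

theorem mem_triv_source {x : X₀} {p : P} : p ∈ (B.triv x).source ↔ B.proj p ∈ B.trivSet x := by
  rw [(B.triv_spec x).1]; rfl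

theorem mem_triv_target {x : X₀} {z : X₀ × G} : z ∈ (B.triv x).target ↔ z.1 ∈ B.trivSet x := by
  rw [(B.triv_spec x).2.1]; simp

theorem contMDiffOn_triv (x : X₀) :
    ContMDiffOn IP (I₀.prod IG) ∞ (B.triv x) (B.triv x).source := (B.triv_spec x).2.2.1

theorem contMDiffOn_triv_symm (x : X₀) :
    ContMDiffOn (I₀.prod IG) IP ∞ (B.triv x).symm (B.triv x).target := (B.triv_spec x).2.2.2.1

theorem triv_fst {x : X₀} {p : P} (hp : B.proj p ∈ B.trivSet x) : (B.triv x p).1 = B.proj p :=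
  (B.triv_spec x).2.2.2.2.1 p (B.mem_triv_source.2 hp)

theorem triv_act {x : X₀} {p : P} (hp : B.proj p ∈ B.trivSet x) (g : G) :
    (B.triv x (B.act p g)).2 = (B.triv x p).2 * g :=
  (B.triv_spec x).2.2.2.2.2 p (B.mem_triv_source.2 hp) g

theorem proj_triv_symm {x : X₀} {z : X₀ × G} (hz : z.1 ∈ B.trivSet x) :
    B.proj ((B.triv x).symm z) = z.1 := by
  have h := B.mem_triv_target.2 hz
  rw [← B.triv_fst (B.mem_triv_source.1 ((B.triv x).map_target h)), (B.triv x).right_inv h]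

theorem triv_triv_symm {x : X₀} {z : X₀ × G} (hz : z.1 ∈ B.trivSet x) :
    B.triv x ((B.triv x).symm z) = z := (B.triv x).right_inv (B.mem_triv_target.2 hz)

theorem triv_symm_triv {x : X₀} {p : P} (hp : B.proj p ∈ B.trivSet x) :
    (B.triv x).symm (B.proj p, (B.triv x p).2) = p := by
  rw [← B.triv_fst hp]
  exact (B.triv x).left_inv (B.mem_triv_source.2 hp)

/-- `(γ, g) ↦ (γ, φ⁻¹(s(γ), g))` for the local trivialization `φ` over `B.trivSet x`. -/
theorem contMDiffOn_triv_symm_src (x : X₀) :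
    ContMDiffOn (I₁.prod IG) IP ∞ (fun z : X₁ × G => (B.triv x).symm (X.src z.1, z.2))
      {z | X.src z.1 ∈ B.trivSet x} :=
  (B.contMDiffOn_triv_symm x).comp
    ((X.submersion_src.smooth.comp contMDiff_fst).prodMk contMDiff_snd).contMDiffOn
    fun _ hz => B.mem_triv_target.2 hz

theorem contMDiffOn_triv_snd (x : X₀) :
    ContMDiffOn IP IG ∞ (fun p : P => (B.triv x p).2) {p | B.proj p ∈ B.trivSet x} :=
  contMDiff_snd.comp_contMDiffOn
    ((B.contMDiffOn_triv x).mono fun _ hp => B.mem_triv_source.2 hp)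

theorem isOpen_src_preimage (x : X₀) : IsOpen {γ | X.src γ ∈ B.trivSet x} :=
  (B.isOpen_trivSet x).preimage X.submersion_src.smooth.continuous

open Classical in
/-- The local trivialization of `s^* P` around `q` pulled back from `P`. -/
def pullbackTriv (q : B.pullback) : OpenPartialHomeomorph B.pullback (X₁ × G) where
  toFun y := (y.1.1, (B.triv (X.src q.1.1) y.1.2).2)
  invFun z :=
    -- The inverse has to be total. Off the target the value `q` is arbitrary and plays no role.
    if h : X.src z.1 ∈ B.trivSet (X.src q.1.1) then
      ⟨(z.1, (B.triv (X.src q.1.1)).symm (X.src z.1, z.2)),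
        (B.proj_triv_symm (z := (X.src z.1, z.2)) h).symm⟩
    else q
  source := {y | X.src y.1.1 ∈ B.trivSet (X.src q.1.1)}
  target := {z | X.src z.1 ∈ B.trivSet (X.src q.1.1)}
  map_source' _ hy := hy
  map_target' z hz := by
    rw [Set.mem_ofPred_eq] at hz
    simp [hz]
  left_inv' y hy := by
    rw [Set.mem_ofPred_eq] at hy
    have hy' : X.src y.1.1 = B.proj y.1.2 := y.2
    simp only [dif_pos hy]
    refine Subtype.ext (Prod.ext rfl ?_)
    simp only [hy']
    exact B.triv_symm_triv (hy' ▸ hy)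
  right_inv' z hz := by
    rw [Set.mem_ofPred_eq] at hz
    simp only [dif_pos hz]
    rw [B.triv_triv_symm (z := (X.src z.1, z.2)) hz]
  open_source := (B.isOpen_src_preimage _).preimage (continuous_fst.comp continuous_subtype_val)
  open_target := (B.isOpen_src_preimage _).preimage continuous_fst
  continuousOn_toFun := by
    refine (continuous_fst.comp continuous_subtype_val).continuousOn.prodMk
      ((B.contMDiffOn_triv_snd _).continuousOn.comp
        (continuous_snd.comp continuous_subtype_val).continuousOn fun y hy => ?_)
    have hy' : X.src y.1.1 = B.proj y.1.2 := y.2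
    have hy : X.src y.1.1 ∈ B.trivSet (X.src q.1.1) := hy
    rw [hy'] at hy
    exact hy
  continuousOn_invFun := by
    rw [Topology.IsInducing.subtypeVal.continuousOn_iff]
    refine (continuous_fst.continuousOn.prodMk
      (B.contMDiffOn_triv_symm_src (X.src q.1.1)).continuousOn).congr fun z hz => ?_
    rw [Set.mem_ofPred_eq] at hz
    simp [dif_pos hz]

theorem pullbackTriv_symm_val {q : B.pullback} {z : X₁ × G}
    (hz : X.src z.1 ∈ B.trivSet (X.src q.1.1)) :
    ((B.pullbackTriv q).symm z).1 = (z.1, (B.triv (X.src q.1.1)).symm (X.src z.1, z.2)) := by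
  simp [pullbackTriv, dif_pos hz]

theorem mem_pullbackTriv_source (q : B.pullback) : q ∈ (B.pullbackTriv q).source :=
  B.mem_trivSet _

instance : ChartedSpace (ModelProd H₁ HG) B.pullback :=
  chartedSpaceOfCover (ModelProd H₁ HG) B.pullbackTriv B.mem_pullbackTriv_source

/-- The transition map is `(γ, g) ↦ (γ, pr₂ φ'(φ⁻¹(s(γ), g)))`, smooth because `s`, `φ'` and `φ⁻¹`
are. -/
theorem contMDiffOn_pullbackTriv_trans (q q' : B.pullback) :
    ContMDiffOn (I₁.prod IG) (I₁.prod IG) ∞ ((B.pullbackTriv q).symm ≫ₕ B.pullbackTriv q')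
      ((B.pullbackTriv q).symm ≫ₕ B.pullbackTriv q').source := by
  have key : ∀ z ∈ ((B.pullbackTriv q).symm ≫ₕ B.pullbackTriv q').source,
      X.src z.1 ∈ B.trivSet (X.src q.1.1) ∧ X.src z.1 ∈ B.trivSet (X.src q'.1.1) := by
    intro z hz
    have h2 : X.src ((B.pullbackTriv q).symm z).1.1 ∈ B.trivSet (X.src q'.1.1) := hz.2
    rw [B.pullbackTriv_symm_val hz.1] at h2
    exact ⟨hz.1, h2⟩
  refine ContMDiffOn.congr (f := fun z : X₁ × G =>
    (z.1, (B.triv (X.src q'.1.1) ((B.triv (X.src q.1.1)).symm (X.src z.1, z.2))).2))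
    (contMDiffOn_fst.prodMk ((B.contMDiffOn_triv_snd _).comp
      ((B.contMDiffOn_triv_symm_src _).mono fun z hz => (key z hz).1) fun z hz => ?_))
    fun z hz => ?_
  · have := B.proj_triv_symm (z := (X.src z.1, z.2)) (key z hz).1
    rw [Set.mem_preimage, Set.mem_ofPred_eq, this]
    exact (key z hz).2
  · change (((B.pullbackTriv q).symm z).1.1,
      (B.triv (X.src q'.1.1) ((B.pullbackTriv q).symm z).1.2).2) = _
    rw [B.pullbackTriv_symm_val (key z hz).1]

theorem isManifold_base_group (B : PrincipalBundleOver X IG G IP P) : IsManifold (I₁.prod IG) ∞ (X₁ × G) :=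
  (X.manifold_mor.prod B.isPrincipalBundle.manifold_group).isManifold

instance : IsManifold (I₁.prod IG) ∞ B.pullback :=
  have := B.isManifold_base_group
  isManifold_chartedSpaceOfCover (hψ := B.mem_pullbackTriv_source) B.contMDiffOn_pullbackTriv_trans

theorem contMDiffOn_pullbackTriv (q : B.pullback) :
    ContMDiffOn (I₁.prod IG) (I₁.prod IG) ∞ (B.pullbackTriv q) (B.pullbackTriv q).source :=
  have := B.isManifold_base_group
  contMDiffOn_cover (hψ := B.mem_pullbackTriv_source) B.contMDiffOn_pullbackTriv_trans q

theorem contMDiffOn_pullbackTriv_symm (q : B.pullback) :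
    ContMDiffOn (I₁.prod IG) (I₁.prod IG) ∞ (B.pullbackTriv q).symm (B.pullbackTriv q).target :=
  have := B.isManifold_base_group
  contMDiffOn_cover_symm (hψ := B.mem_pullbackTriv_source) B.contMDiffOn_pullbackTriv_trans q

/-- In a local trivialization the inclusion reads `(γ, g) ↦ (γ, φ⁻¹(s(γ), g))`. -/
theorem contMDiff_pullback_val :
    ContMDiff (I₁.prod IG) (I₁.prod IP) ∞ (Subtype.val : B.pullback → X₁ × P) := by
  intro q
  have hq := B.mem_pullbackTriv_source q
  have h := (contMDiffOn_fst.prodMk (B.contMDiffOn_triv_symm_src (X.src q.1.1))).comp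
    (B.contMDiffOn_pullbackTriv q) fun y hy => hy
  refine (h.contMDiffAt ((B.pullbackTriv q).open_source.mem_nhds hq)).congr_of_eventuallyEq ?_
  filter_upwards [(B.pullbackTriv q).open_source.mem_nhds hq] with y hy
  have := B.pullbackTriv_symm_val (q := q) (z := B.pullbackTriv q y) hy
  rwa [(B.pullbackTriv q).left_inv hy] at this

/-- A map into `s^* P` is smooth if it is smooth as a map into `X₁ × P`. -/
theorem contMDiffOn_pullback {f : M → B.pullback} {s : Set M}
    (h : ContMDiffOn IM (I₁.prod IP) ∞ (fun x => (f x).1) s) :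
    ContMDiffOn IM (I₁.prod IG) ∞ f s := by
  intro x hx
  -- Continuity comes first, from the subspace topology: it keeps `f` inside one trivialization near
  -- `x`, where smoothness can be tested in coordinates.
  have hc : ContinuousWithinAt f s x :=
    Topology.IsInducing.subtypeVal.continuousWithinAt_iff.2 (h x hx).continuousWithinAt
  have hmem := hc ((B.pullbackTriv (f x)).open_source.mem_nhds (B.mem_pullbackTriv_source (f x)))
  have h1 : ContMDiffWithinAt IM (I₁.prod IG) ∞ (fun y => B.pullbackTriv (f x) (f y)) s x := by
    refine (contMDiffWithinAt_fst.comp x (h x hx) (Set.mapsTo_univ _ _)).prodMk ?_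
    refine ContMDiffAt.comp_contMDiffWithinAt (I' := IP) x
      (g := fun p => (B.triv (X.src (f x).1.1) p).2) (f := fun y => (f y).1.2) ?_
      (contMDiffWithinAt_snd.comp x (h x hx) (Set.mapsTo_univ _ _))
    refine (B.contMDiffOn_triv_snd _).contMDiffAt
      (((B.isOpen_trivSet _).preimage
        B.isPrincipalBundle.smooth_proj.continuous).mem_nhds ?_)
    have hx' : X.src (f x).1.1 = B.proj (f x).1.2 := (f x).2
    exact hx' ▸ B.mem_trivSet _
  have h2 : ContMDiffAt (I₁.prod IG) (I₁.prod IG) ∞ (B.pullbackTriv (f x)).symm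
      (B.pullbackTriv (f x) (f x)) :=
    (B.contMDiffOn_pullbackTriv_symm (f x)).contMDiffAt
      ((B.pullbackTriv (f x)).open_target.mem_nhds
        ((B.pullbackTriv (f x)).map_source (B.mem_pullbackTriv_source (f x))))
  refine (h2.comp_contMDiffWithinAt x h1).congr_of_eventuallyEq ?_
    ((B.pullbackTriv (f x)).left_inv (B.mem_pullbackTriv_source (f x))).symm
  filter_upwards [hmem] with y hy
  exact ((B.pullbackTriv (f x)).left_inv hy).symm

theorem contMDiff_pullback {f : M → B.pullback}
    (h : ContMDiff IM (I₁.prod IP) ∞ (fun x => (f x).1)) : ContMDiff IM (I₁.prod IG) ∞ f :=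
  contMDiffOn_univ.1 (B.contMDiffOn_pullback (contMDiffOn_univ.2 h))

theorem isSmoothManifold_pullback : IsSmoothManifold (I₁.prod IG) B.pullback := by
  obtain ⟨_, _, _, _, _⟩ := X.manifold_mor
  obtain ⟨_, _, _, _, _⟩ := B.isPrincipalBundle.manifold_group
  obtain ⟨_, _, _, _, _⟩ := B.isPrincipalBundle.manifold_total
  exact ⟨inferInstance, inferInstance, inferInstance, inferInstance, inferInstance⟩

theorem isEmbeddedSubmanifold_pullback :
    IsEmbeddedSubmanifold (I₁.prod IG) (I₁.prod IP) B.pullback where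
  isSmoothManifold := B.isSmoothManifold_pullback
  smooth_val := B.contMDiff_pullback_val
  mfderiv_val_injective q := by
    have hq := B.mem_pullbackTriv_source q
    have hq' : X.src q.1.1 = B.proj q.1.2 := q.2
    -- A local smooth retraction of `X₁ × P` onto `s^* P`: the coordinates `(γ, pr₂ φ(p))` make
    -- sense without `s(γ) = π(p)`, and on `s^* P` they recover the point.
    have h1 : ContMDiffAt (I₁.prod IP) (I₁.prod IG) ∞
        (fun y : X₁ × P => (B.pullbackTriv q).symm (y.1, (B.triv (X.src q.1.1) y.2).2)) q.1 := by
      refine ContMDiffAt.comp (I' := I₁.prod IG) q.1 (g := (B.pullbackTriv q).symm)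
        (f := fun y : X₁ × P => (y.1, (B.triv (X.src q.1.1) y.2).2)) ?_ ?_
      · exact (B.contMDiffOn_pullbackTriv_symm q).contMDiffAt
          ((B.pullbackTriv q).open_target.mem_nhds ((B.pullbackTriv q).map_source hq))
      · refine contMDiffAt_fst.prodMk (ContMDiffAt.comp (I' := IP) q.1
          (g := fun p : P => (B.triv (X.src q.1.1) p).2) (f := Prod.snd) ?_ contMDiffAt_snd)
        refine (B.contMDiffOn_triv_snd _).contMDiffAt (((B.isOpen_trivSet _).preimage
          B.isPrincipalBundle.smooth_proj.continuous).mem_nhds ?_)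
        exact hq' ▸ B.mem_trivSet _
    refine Function.LeftInverse.injective (g := mfderiv (I₁.prod IP) (I₁.prod IG) _ q.1)
      (mfderiv_comp_of_eventually_leftInverse
        (B.contMDiff_pullback_val.mdifferentiableAt (by simp))
        (h1.mdifferentiableAt (by simp)) ?_)
    filter_upwards [(B.pullbackTriv q).open_source.mem_nhds hq] with y hy
    exact (B.pullbackTriv q).left_inv hy

end PrincipalBundleOver

/-! ### The decorated groupoid is a Lie groupoid -/

namespace LieGroupoid

variable {E₀ H₀ X₀ E₁ H₁ X₁ : Type*}
  [NormedAddCommGroup E₀] [NormedSpace ℝ E₀] [TopologicalSpace H₀]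
  [NormedAddCommGroup E₁] [NormedSpace ℝ E₁] [TopologicalSpace H₁]
  {I₀ : ModelWithCorners ℝ E₀ H₀} [TopologicalSpace X₀] [ChartedSpace H₀ X₀]
  {I₁ : ModelWithCorners ℝ E₁ H₁} [TopologicalSpace X₁] [ChartedSpace H₁ X₁]
  (X : LieGroupoid I₀ X₀ I₁ X₁)

theorem comp_congr {g g' f f' : X₁} (hg : g = g') (hf : f = f') (h : X.src g = X.tgt f)
    (h' : X.src g' = X.tgt f') : X.comp ⟨(g, f), h⟩ = X.comp ⟨(g', f'), h'⟩ := by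
  subst hg hf; rfl

/-- Uniqueness of inverses: both `γ` and the double inverse are inverse to `γ⁻¹`. This makes the
inversion of the decorated groupoid an involution. -/
theorem inv_inv (γ : X₁) : X.inv (X.inv γ) = γ := by
  have h1 : X.src (X.inv (X.inv γ)) = X.tgt (X.inv γ) := X.src_inv _
  have h2 : X.src (X.inv γ) = X.tgt γ := X.src_inv _
  have h3 : X.src (X.comp ⟨(X.inv (X.inv γ), X.inv γ), h1⟩) = X.tgt γ :=
    (X.src_comp _ _ _).trans h2
  have h4 : X.src (X.inv (X.inv γ)) = X.tgt (X.comp ⟨(X.inv γ, γ), h2⟩) :=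
    h1.trans (X.tgt_comp _ _ _).symm
  have e1 : X.unit (X.src (X.inv (X.inv γ))) = X.comp ⟨(X.inv γ, γ), h2⟩ := by
    rw [X.inv_comp, h1, X.tgt_inv]
  have e2 : X.comp ⟨(X.inv (X.inv γ), X.inv γ), h1⟩ = X.unit (X.tgt γ) := by
    rw [X.inv_comp, h2]
  calc X.inv (X.inv γ)
      = X.comp ⟨(X.inv (X.inv γ), X.unit (X.src (X.inv (X.inv γ)))), (X.tgt_unit _).symm⟩ :=
        (X.comp_unit _ _).symm
    _ = X.comp ⟨(X.inv (X.inv γ), X.comp ⟨(X.inv γ, γ), h2⟩), h4⟩ := X.comp_congr rfl e1 _ _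
    _ = X.comp ⟨(X.comp ⟨(X.inv (X.inv γ), X.inv γ), h1⟩, γ), h3⟩ := (X.assoc _ _ _ _ _ _ _).symm
    _ = X.comp ⟨(X.unit (X.tgt γ), γ), X.src_unit _⟩ := X.comp_congr e2 rfl _ _
    _ = γ := X.unit_comp _ _

end LieGroupoid

namespace PrincipalBundleOver

set_option linter.unusedSectionVars false

variable {E₀ H₀ X₀ E₁ H₁ X₁ EG HG G EH HH H EP HP P : Type*}
  [NormedAddCommGroup E₀] [NormedSpace ℝ E₀] [TopologicalSpace H₀]
  [NormedAddCommGroup E₁] [NormedSpace ℝ E₁] [TopologicalSpace H₁]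
  {I₀ : ModelWithCorners ℝ E₀ H₀} [TopologicalSpace X₀] [ChartedSpace H₀ X₀]
  {I₁ : ModelWithCorners ℝ E₁ H₁} [TopologicalSpace X₁] [ChartedSpace H₁ X₁]
  {X : LieGroupoid I₀ X₀ I₁ X₁}
  [NormedAddCommGroup EG] [NormedSpace ℝ EG] [TopologicalSpace HG]
  [NormedAddCommGroup EH] [NormedSpace ℝ EH] [TopologicalSpace HH]
  [NormedAddCommGroup EP] [NormedSpace ℝ EP] [TopologicalSpace HP]
  {IG : ModelWithCorners ℝ EG HG} [TopologicalSpace G] [ChartedSpace HG G] [Group G]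
  {IH : ModelWithCorners ℝ EH HH} [TopologicalSpace H] [ChartedSpace HH H] [Group H]
  {IP : ModelWithCorners ℝ EP HP} [TopologicalSpace P] [ChartedSpace HP P]
  (B : PrincipalBundleOver X IG G IP P) (C : LieCrossedModule IG G IH H)

theorem contMDiff_μ : ContMDiff (I₁.prod IG) IP ∞ B.μ := by
  obtain ⟨F, hF, hF'⟩ := B.smooth_μ
  exact (hF.comp_contMDiff B.contMDiff_pullback_val fun q => q.2).congr fun q => (hF' q).symm

theorem contMDiff_decProj : ContMDiff ((I₁.prod IG).prod IH) I₁ ∞ (B.decProj (H := H)) :=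
  contMDiff_fst.comp (B.contMDiff_pullback_val.comp contMDiff_fst)

theorem contMDiff_decSrc : ContMDiff ((I₁.prod IG).prod IH) IP ∞ (B.decSrc (H := H)) :=
  contMDiff_snd.comp (B.contMDiff_pullback_val.comp contMDiff_fst)

theorem contMDiff_decTgt : ContMDiff ((I₁.prod IG).prod IH) IP ∞ (B.decTgt C) := by
  have := C.lieGroup_H
  exact B.isPrincipalBundle.smooth_act.comp ((B.contMDiff_μ.comp contMDiff_fst).prodMk
    (C.smooth_τ.comp (contMDiff_snd (J := IH) (N := H)).inv))

theorem contMDiff_decUnit : ContMDiff IP ((I₁.prod IG).prod IH) ∞ (B.decUnit (H := H)) :=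
  ContMDiff.prodMk (B.contMDiff_pullback
    ((X.smooth_unit.comp B.isPrincipalBundle.smooth_proj).prodMk contMDiff_id)) contMDiff_const

theorem contMDiff_decInv :
    ContMDiff ((I₁.prod IG).prod IH) ((I₁.prod IG).prod IH) ∞ (B.decInv C) := by
  have := C.lieGroup_H
  exact ContMDiff.prodMk (B.contMDiff_pullback
    ((X.smooth_inv.comp B.contMDiff_decProj).prodMk (B.contMDiff_decTgt C)))
    (contMDiff_snd (J := IH) (N := H)).inv

open Classical in
theorem smooth_decComp :
    SmoothOnSubset (((I₁.prod IG).prod IH).prod ((I₁.prod IG).prod IH))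
      ((I₁.prod IG).prod IH) (B.decComp C) := by
  have := C.lieGroup_H
  obtain ⟨F, hF, hF'⟩ := X.smooth_comp
  -- An extension of the composition by the arbitrary value `q.1`. Only its restriction to
  -- composable pairs has to be smooth.
  let Φ : (B.pullback × H) × (B.pullback × H) → B.pullback × H := fun q =>
    if h : q ∈ fibreProd (B.decSrc (H := H)) (B.decTgt C) then B.decComp C ⟨q, h⟩ else q.1
  have hΦ : ∀ q (h : q ∈ fibreProd (B.decSrc (H := H)) (B.decTgt C)),
      Φ q = B.decComp C ⟨q, h⟩ := fun q h => dif_pos h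
  refine ⟨Φ, ?_, fun q => hΦ q.1 q.2⟩
  have h1 : ContMDiffOn (((I₁.prod IG).prod IH).prod ((I₁.prod IG).prod IH)) I₁ ∞
      (fun q : (B.pullback × H) × (B.pullback × H) => F (B.decProj q.1, B.decProj q.2))
      (fibreProd (B.decSrc (H := H)) (B.decTgt C)) :=
    hF.comp ((B.contMDiff_decProj.comp contMDiff_fst).prodMk
      (B.contMDiff_decProj.comp contMDiff_snd)).contMDiffOn fun q hq => B.src_eq_tgt C hq
  have h2 : ContMDiff (((I₁.prod IG).prod IH).prod ((I₁.prod IG).prod IH)) IP ∞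
      (fun q : (B.pullback × H) × (B.pullback × H) => B.decSrc q.2) :=
    B.contMDiff_decSrc.comp contMDiff_snd
  have h3 : ContMDiff (((I₁.prod IG).prod IH).prod ((I₁.prod IG).prod IH)) IH ∞
      (fun q : (B.pullback × H) × (B.pullback × H) => q.1.2 * q.2.2) :=
    ContMDiff.mul (contMDiff_snd.comp contMDiff_fst) (contMDiff_snd.comp contMDiff_snd)
  refine ContMDiffOn.prodMk (f := fun q => (Φ q).1) (g := fun q => (Φ q).2)
    (B.contMDiffOn_pullback ((h1.prodMk h2.contMDiffOn).congr fun q hq => ?_))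
    (h3.contMDiffOn.congr fun q hq => ?_)
  · rw [hΦ q hq]
    exact Prod.ext (hF' ⟨(B.decProj q.1, B.decProj q.2), B.src_eq_tgt C hq⟩).symm rfl
  · rw [hΦ q hq]
    rfl

theorem decTgt_decUnit (p : P) : B.decTgt C (B.decUnit p) = p := by
  simp [decTgt, decUnit, B.μ_unit, B.isPrincipalBundle.act_one]

/-- Since `μ` commutes with `G`, the factor `τ(h⁻¹)` moves out of `μ(γ⁻¹, ·)` and cancels against
`τ(h)`. What remains is `μ(γ⁻¹, μ(γ, p)) = μ(γ⁻¹ ∘ γ, p) = p`. -/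
theorem decTgt_decInv (a : B.pullback × H) : B.decTgt C (B.decInv C a) = B.decSrc a := by
  obtain ⟨⟨⟨γ, p⟩, hq⟩, h⟩ := a
  have hq' : X.src γ = B.proj p := hq
  have e1 : X.src (X.inv γ) = B.proj (B.μ ⟨(γ, p), hq⟩) :=
    (X.src_inv γ).trans (B.proj_μ _ _ _).symm
  have e2 : X.src (X.inv γ) = B.proj (B.act (B.μ ⟨(γ, p), hq⟩) (C.τ h⁻¹)) :=
    e1.trans (B.isPrincipalBundle.proj_act _ _).symm
  have e3 : X.src (X.comp ⟨(X.inv γ, γ), X.src_inv γ⟩) = B.proj p :=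
    (X.src_comp _ _ _).trans hq'
  change B.act (B.μ ⟨(X.inv γ, B.act (B.μ ⟨(γ, p), hq⟩) (C.τ h⁻¹)), e2⟩) (C.τ (h⁻¹)⁻¹) = p
  rw [← B.μ_act _ _ _ e1, ← B.isPrincipalBundle.act_mul, ← map_mul, mul_inv_cancel, map_one,
    B.isPrincipalBundle.act_one, ← B.μ_comp _ _ _ (X.src_inv γ) hq' e3]
  have e4 : X.comp ⟨(X.inv γ, γ), X.src_inv γ⟩ = X.unit (B.proj p) := by
    rw [X.inv_comp, hq']
  simp only [e4]
  exact B.μ_unit _ _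

/-- The target of `b` is `μ(γ', μ(γ, p)) τ(k⁻¹) τ(k'⁻¹)`, and `k⁻¹ k'⁻¹ = (k' k)⁻¹`. The inverse in
the target map is what reconciles the right action with the order of composition. -/
theorem decTgt_decComp (b a : B.pullback × H) (h : B.decSrc b = B.decTgt C a) :
    B.decTgt C (B.decComp C ⟨(b, a), h⟩) = B.decTgt C b := by
  obtain ⟨⟨⟨γ', p'⟩, hq'⟩, k'⟩ := b
  obtain ⟨⟨⟨γ, p⟩, hq⟩, k⟩ := a
  have e0 : X.src γ' = X.tgt γ := B.src_eq_tgt C h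
  obtain rfl : p' = B.act (B.μ ⟨(γ, p), hq⟩) (C.τ k⁻¹) := h
  have e1 : X.src γ' = B.proj (B.μ ⟨(γ, p), hq⟩) := e0.trans (B.proj_μ _ _ _).symm
  change B.act (B.μ ⟨(X.comp ⟨(γ', γ), e0⟩, p), _⟩) (C.τ (k' * k)⁻¹) =
    B.act (B.μ ⟨(γ', B.act (B.μ ⟨(γ, p), hq⟩) (C.τ k⁻¹)), hq'⟩) (C.τ k'⁻¹)
  have e2 : B.μ ⟨(X.comp ⟨(γ', γ), e0⟩, p), (X.src_comp _ _ _).trans hq⟩ =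
      B.μ ⟨(γ', B.μ ⟨(γ, p), hq⟩), e1⟩ := B.μ_comp _ _ _ e0 hq _ e1
  rw [e2, ← (B.μ_act _ _ _ e1 hq' :), ← B.isPrincipalBundle.act_mul, ← map_mul, ← mul_inv_rev]

theorem decInv_decInv (a : B.pullback × H) : B.decInv C (B.decInv C a) = a := by
  exact Prod.ext (Subtype.ext (Prod.ext (X.inv_inv _) (B.decTgt_decInv C a))) (inv_inv _)

theorem surjective_decSrc : Function.Surjective (B.decSrc (H := H)) :=
  fun p => ⟨B.decUnit p, rfl⟩

/-- Restricted to a slice of constant `h` and read in a local trivialization, the source is `(γ, g)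
↦ φ⁻¹(s(γ), g)`, a submersion because `s` is one and `φ⁻¹` is a local diffeomorphism. Surjectivity
of the differential on the slice suffices. -/
theorem isSurjectiveSubmersion_decSrc :
    IsSurjectiveSubmersion ((I₁.prod IG).prod IH) IP (B.decSrc (H := H)) where
  smooth := B.contMDiff_decSrc
  surjective := B.surjective_decSrc
  mfderiv_surjective := by
    rintro ⟨q, h⟩
    have hq' : X.src q.1.1 = B.proj q.1.2 := q.2
    have hq := B.mem_pullbackTriv_source q
    set e := B.pullbackTriv q
    set x := X.src q.1.1
    have hpx : B.proj q.1.2 ∈ B.trivSet x := hq' ▸ B.mem_trivSet _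
    let z := e q
    have hz : X.src z.1 ∈ B.trivSet x := hq
    have hez : e.symm z = q := e.left_inv hq
    -- `(γ, g) ↦ (s(γ), g)`
    let S : X₁ × G → X₀ × G := Prod.map X.src id
    have hS : ContMDiff (I₁.prod IG) (I₀.prod IG) ∞ S := X.submersion_src.smooth.prodMap contMDiff_id
    have hSz : S z = B.triv x q.1.2 :=
      Prod.ext (hq'.trans (B.triv_fst hpx).symm) rfl
    have hS' : Function.Surjective (mfderiv (I₁.prod IG) (I₀.prod IG) S z) := by
      rw [mfderiv_prodMap (X.submersion_src.smooth.mdifferentiable (by simp) z.1)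
        mdifferentiableAt_id, mfderiv_id]
      rintro ⟨a, b⟩
      obtain ⟨u, rfl⟩ := X.submersion_src.mfderiv_surjective z.1 a
      exact ⟨(u, b), rfl⟩
    have htm : (B.triv x).source ∈ nhds q.1.2 :=
      (B.triv x).open_source.mem_nhds (B.mem_triv_source.2 hpx)
    have hT : MDifferentiableAt IP (I₀.prod IG) (B.triv x) q.1.2 :=
      ((B.contMDiffOn_triv x).contMDiffAt htm).mdifferentiableAt (by simp)
    have hTs : MDifferentiableAt (I₀.prod IG) IP (B.triv x).symm (S z) :=
      ((B.contMDiffOn_triv_symm x).contMDiffAt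
        ((B.triv x).open_target.mem_nhds (B.mem_triv_target.2 hz))).mdifferentiableAt (by simp)
    -- Differentiating `φ⁻¹ ∘ φ = id` exhibits `dφ` as a right inverse of `d(φ⁻¹)`.
    have hTs' : Function.Surjective (mfderiv (I₀.prod IG) IP (B.triv x).symm (S z)) := by
      rw [hSz] at hTs ⊢
      have key := mfderiv_comp_of_eventually_leftInverse hT hTs
        (by filter_upwards [htm] with y hy using (B.triv x).left_inv hy)
      rw [(B.triv x).left_inv (B.mem_triv_source.2 hpx)]
      exact fun v => ⟨_, key v⟩
    have hcomp : Function.Surjective (mfderiv (I₁.prod IG) IP ((B.triv x).symm ∘ S) z) := by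
      rw [mfderiv_comp z hTs (hS.mdifferentiable (by simp) z)]
      exact hTs'.comp hS'
    have hsec : MDifferentiableAt (I₁.prod IG) ((I₁.prod IG).prod IH)
        (fun w => (e.symm w, h)) z :=
      ((((B.contMDiffOn_pullbackTriv_symm q).contMDiffAt
        (e.open_target.mem_nhds hz)).prodMk contMDiffAt_const).mdifferentiableAt (by simp))
    have main : Function.Surjective
        (mfderiv ((I₁.prod IG).prod IH) IP (B.decSrc (H := H)) (e.symm z, h)) :=
      mfderiv_surjective_of_comp (f := fun w => (e.symm w, h)) (x := z) (g := B.decSrc (H := H))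
        hsec
      (B.contMDiff_decSrc.mdifferentiable (by simp) _) (by
        rw [Filter.EventuallyEq.mfderiv_eq (f := (B.triv x).symm ∘ S)]
        · exact hcomp
        · filter_upwards [e.open_target.mem_nhds hz] with w hw
          exact congrArg Prod.snd (B.pullbackTriv_symm_val hw))
    rw [hez] at main
    exact main

/-- The target after the inversion is the source, already known to be a submersion. As the inversion
is an involution, every point `a` is the inverse of some point. -/
theorem isSurjectiveSubmersion_decTgt :
    IsSurjectiveSubmersion ((I₁.prod IG).prod IH) IP (B.decTgt C) where
  smooth := B.contMDiff_decTgt C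
  surjective p := ⟨B.decUnit p, B.decTgt_decUnit C p⟩
  mfderiv_surjective a := by
    have main := mfderiv_surjective_of_comp (I := (I₁.prod IG).prod IH)
      (f := B.decInv C) (g := B.decTgt C) (x := B.decInv C a) (I'' := IP)
      ((B.contMDiff_decInv C).mdifferentiable (by simp) _)
      ((B.contMDiff_decTgt C).mdifferentiable (by simp) _) (by
        rw [show B.decTgt C ∘ B.decInv C = B.decSrc from funext (B.decTgt_decInv C)]
        exact B.isSurjectiveSubmersion_decSrc.mfderiv_surjective _)
    rwa [B.decInv_decInv C a] at main

/-- The decorated Lie groupoid `[s^* P × H ⇉ P]`. -/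
def decorated : LieGroupoid IP P ((I₁.prod IG).prod IH) (B.pullback × H) where
  src := B.decSrc
  tgt := B.decTgt C
  comp := B.decComp C
  unit := B.decUnit
  inv := B.decInv C
  src_comp _ _ _ := rfl
  tgt_comp := B.decTgt_decComp C
  assoc _ _ _ _ _ _ _ :=
    Prod.ext (Subtype.ext (Prod.ext (X.assoc _ _ _ _ _ _ _) rfl)) (mul_assoc _ _ _)
  src_unit _ := rfl
  tgt_unit := B.decTgt_decUnit C
  unit_comp f _ := by
    refine Prod.ext (Subtype.ext (Prod.ext ?_ rfl)) (one_mul _)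
    simp only [decComp, decUnit, B.proj_decTgt C f]
    exact X.unit_comp _ _
  comp_unit f _ := by
    have hf : X.src f.1.1.1 = B.proj (B.decSrc f) := f.1.2
    refine Prod.ext (Subtype.ext (Prod.ext ?_ rfl)) (mul_one _)
    simp only [decComp, decUnit, ← hf]
    exact X.comp_unit _ _
  src_inv _ := rfl
  tgt_inv := B.decTgt_decInv C
  inv_comp f _ := by
    have hf : X.src f.1.1.1 = B.proj (B.decSrc f) := f.1.2
    refine Prod.ext (Subtype.ext (Prod.ext ?_ rfl)) (inv_mul_cancel _)
    simp only [decUnit, ← hf]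
    exact X.inv_comp _ _
  comp_inv f _ := by
    refine Prod.ext (Subtype.ext (Prod.ext ?_ rfl)) (mul_inv_cancel _)
    simp only [decUnit, B.proj_decTgt C f]
    exact X.comp_inv _ _
  manifold_obj := B.isPrincipalBundle.manifold_total
  manifold_mor := B.isSmoothManifold_pullback.prod C.manifold_H
  submersion_src := B.isSurjectiveSubmersion_decSrc
  submersion_tgt := B.isSurjectiveSubmersion_decTgt C
  smooth_comp := B.smooth_decComp C
  smooth_unit := B.contMDiff_decUnit
  smooth_inv := B.contMDiff_decInv C

end PrincipalBundleOver

/-! ### The decorated groupoid is a principal bundle for the Lie 2-group -/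

namespace PrincipalBundleOver

set_option linter.unusedSectionVars false

variable {E₀ H₀ X₀ E₁ H₁ X₁ EG HG G EH HH H EP HP P : Type*}
  [NormedAddCommGroup E₀] [NormedSpace ℝ E₀] [TopologicalSpace H₀]
  [NormedAddCommGroup E₁] [NormedSpace ℝ E₁] [TopologicalSpace H₁]
  {I₀ : ModelWithCorners ℝ E₀ H₀} [TopologicalSpace X₀] [ChartedSpace H₀ X₀]
  {I₁ : ModelWithCorners ℝ E₁ H₁} [TopologicalSpace X₁] [ChartedSpace H₁ X₁]
  {X : LieGroupoid I₀ X₀ I₁ X₁}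
  [NormedAddCommGroup EG] [NormedSpace ℝ EG] [TopologicalSpace HG]
  [NormedAddCommGroup EH] [NormedSpace ℝ EH] [TopologicalSpace HH]
  [NormedAddCommGroup EP] [NormedSpace ℝ EP] [TopologicalSpace HP]
  {IG : ModelWithCorners ℝ EG HG} [TopologicalSpace G] [ChartedSpace HG G] [Group G]
  {IH : ModelWithCorners ℝ EH HH} [TopologicalSpace H] [ChartedSpace HH H] [Group H]
  {IP : ModelWithCorners ℝ EP HP} [TopologicalSpace P] [ChartedSpace HP P]
  (B : PrincipalBundleOver X IG G IP P) (C : LieCrossedModule IG G IH H)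

theorem contMDiff_decAct :
    ContMDiff (((I₁.prod IG).prod IH).prod (IH.prod IG)) ((I₁.prod IG).prod IH) ∞
      (fun q : (B.pullback × H) × C.Mor => B.decAct C q.1 q.2) := by
  have := C.lieGroup_H
  have := C.lieGroup_G
  have hk1 : ContMDiff (((I₁.prod IG).prod IH).prod (IH.prod IG)) IH ∞
      (fun q : (B.pullback × H) × (H × G) => q.2.1) := contMDiff_fst.comp contMDiff_snd
  have hk2 : ContMDiff (((I₁.prod IG).prod IH).prod (IH.prod IG)) IG ∞
      (fun q : (B.pullback × H) × (H × G) => q.2.2) := contMDiff_snd.comp contMDiff_snd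
  have hh : ContMDiff (((I₁.prod IG).prod IH).prod (IH.prod IG)) IH ∞
      (fun q : (B.pullback × H) × (H × G) => q.1.2) := contMDiff_snd.comp contMDiff_fst
  have h1 : ContMDiff (((I₁.prod IG).prod IH).prod (IH.prod IG)) (I₁.prod IP) ∞
      (fun q : (B.pullback × H) × (H × G) =>
        ((B.decProj q.1, B.act (B.decSrc q.1) q.2.2) : X₁ × P)) :=
    (B.contMDiff_decProj.comp contMDiff_fst).prodMk
      (B.isPrincipalBundle.smooth_act.comp ((B.contMDiff_decSrc.comp contMDiff_fst).prodMk hk2))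
  exact ContMDiff.prodMk
    (B.contMDiff_pullback (f := fun q : (B.pullback × H) × (H × G) => (B.decAct C q.1 q.2).1) h1)
    (C.smooth_α.comp (hk2.inv.prodMk (hk1.inv.mul hh)))

theorem contMDiffOn_decTriv_toFun (q : B.pullback) :
    ContMDiffOn ((I₁.prod IG).prod IH) (I₁.prod (IH.prod IG)) ∞
      (fun a : B.pullback × H => (((B.pullbackTriv q a.1).1,
        ((C.α (B.pullbackTriv q a.1).2 a.2)⁻¹, (B.pullbackTriv q a.1).2)) : X₁ × (H × G)))
      {a | a.1 ∈ (B.pullbackTriv q).source} := by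
  have := C.lieGroup_H
  have h : ContMDiffOn ((I₁.prod IG).prod IH) (I₁.prod IG) ∞
      (fun a : B.pullback × H => B.pullbackTriv q a.1) {a | a.1 ∈ (B.pullbackTriv q).source} :=
    (B.contMDiffOn_pullbackTriv q).comp contMDiffOn_fst fun _ ha => ha
  have h1 := contMDiff_fst.comp_contMDiffOn h
  have h2 := contMDiff_snd.comp_contMDiffOn h
  exact h1.prodMk ((C.smooth_α.comp_contMDiffOn (h2.prodMk contMDiffOn_snd)).inv.prodMk h2)

theorem contMDiffOn_decTriv_invFun (q : B.pullback) :
    ContMDiffOn (I₁.prod (IH.prod IG)) ((I₁.prod IG).prod IH) ∞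
      (fun z : X₁ × (H × G) => ((B.pullbackTriv q).symm (z.1, z.2.2), C.α z.2.2⁻¹ z.2.1⁻¹))
      {z | (z.1, z.2.2) ∈ (B.pullbackTriv q).target} := by
  have := C.lieGroup_H
  have := C.lieGroup_G
  have hg : ContMDiff (I₁.prod (IH.prod IG)) IG ∞ (fun z : X₁ × (H × G) => z.2.2) :=
    contMDiff_snd.comp contMDiff_snd
  have hh : ContMDiff (I₁.prod (IH.prod IG)) IH ∞ (fun z : X₁ × (H × G) => z.2.1) :=
    contMDiff_fst.comp contMDiff_snd
  exact ((B.contMDiffOn_pullbackTriv_symm q).comp (contMDiff_fst.prodMk hg).contMDiffOn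
    fun _ hz => hz).prodMk (C.smooth_α.comp (hg.inv.prodMk hh.inv)).contMDiffOn

/-- The local trivialization `(γ, p, h) ↦ (γ, (α_g(h)⁻¹, g))` of `s^* P × H → X₁`, where `g` is the
`G`-coordinate of `p` in a local trivialization of `P`. -/
def decTriv (q : B.pullback) : OpenPartialHomeomorph (B.pullback × H) (X₁ × C.Mor) where
  toFun a := ((B.pullbackTriv q a.1).1,
    ((C.α (B.pullbackTriv q a.1).2 a.2)⁻¹, (B.pullbackTriv q a.1).2))
  invFun z := ((B.pullbackTriv q).symm (z.1, z.2.2), C.α z.2.2⁻¹ z.2.1⁻¹)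
  source := {a | a.1 ∈ (B.pullbackTriv q).source}
  target := {z | (z.1, z.2.2) ∈ (B.pullbackTriv q).target}
  map_source' a ha := (B.pullbackTriv q).map_source ha
  map_target' z hz := (B.pullbackTriv q).map_target hz
  left_inv' a ha := by
    refine Prod.ext ((B.pullbackTriv q).left_inv ha) ?_
    simp
  right_inv' z hz := by
    have := (B.pullbackTriv q).right_inv hz
    simp only [this]
    refine Prod.ext rfl (Prod.ext ?_ rfl)
    simp
  open_source := (B.pullbackTriv q).open_source.preimage continuous_fst
  open_target := (B.pullbackTriv q).open_target.preimage
    (continuous_fst.prodMk (continuous_snd.comp continuous_snd) :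
      Continuous fun z : X₁ × (H × G) => (z.1, z.2.2))
  continuousOn_toFun := (B.contMDiffOn_decTriv_toFun C q).continuousOn
  continuousOn_invFun := (B.contMDiffOn_decTriv_invFun C q).continuousOn

/-- The local trivializations are indexed by points of `s^* P`, so each `γ` must be lifted before
one over a neighbourhood of it can be chosen. -/
theorem surjective_decProj : Function.Surjective (B.decProj (H := H)) := by
  intro γ
  exact ⟨(⟨(γ, (B.triv (X.src γ)).symm (X.src γ, 1)),
    (B.proj_triv_symm (z := (X.src γ, 1)) (B.mem_trivSet _)).symm⟩, 1), rfl⟩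

theorem isPrincipalBundle_decProj :
    IsPrincipalBundle (IH.prod IG) ((I₁.prod IG).prod IH) I₁ B.decProj (B.decAct C) where
  manifold_group := C.manifold_H.prod C.manifold_G
  lieGroup := C.lieGroup_mor
  manifold_total := B.isSmoothManifold_pullback.prod C.manifold_H
  manifold_base := X.manifold_mor
  act_one a := by
    refine Prod.ext (Subtype.ext (Prod.ext rfl (B.isPrincipalBundle.act_one _))) ?_
    change C.α 1⁻¹ (1⁻¹ * a.2) = a.2
    simp
  act_mul a k l := by
    refine Prod.ext (Subtype.ext (Prod.ext rfl (B.isPrincipalBundle.act_mul _ _ _))) ?_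
    change C.α (k.2 * l.2)⁻¹ ((k.1 * C.α k.2 l.1)⁻¹ * a.2) =
      C.α l.2⁻¹ (l.1⁻¹ * C.α k.2⁻¹ (k.1⁻¹ * a.2))
    simp [mul_assoc]
  smooth_act := B.contMDiff_decAct C
  smooth_proj := B.contMDiff_decProj
  proj_act _ _ := rfl
  locally_trivial γ := by
    obtain ⟨a, rfl⟩ := B.surjective_decProj (H := H) γ
    refine ⟨{γ | X.src γ ∈ B.trivSet (X.src a.1.1.1)}, B.isOpen_src_preimage _,
      B.mem_trivSet _, B.decTriv C a.1, rfl, ?_, B.contMDiffOn_decTriv_toFun C a.1,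
      B.contMDiffOn_decTriv_invFun C a.1, fun _ _ => rfl, fun b hb k => ?_⟩
    · ext z
      exact ⟨fun h => ⟨h, trivial⟩, fun h => h.1⟩
    · have hb' : X.src b.1.1.1 = B.proj b.1.1.2 := b.1.2
      have hb : X.src b.1.1.1 ∈ B.trivSet (X.src a.1.1.1) := hb
      rw [hb'] at hb
      have key := B.triv_act hb k.2
      refine Prod.ext ?_ key
      -- With `g` the coordinate of `p`, that of `p k₂` is `g k₂`, so `α` of it cancels `α_{k₂⁻¹}`
      -- and leaves `α_g(k₁⁻¹ h)⁻¹ = α_g(h)⁻¹ α_g(k₁)`. This is the `H`-part of a product in `H ⋊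
      -- G`, which explains the inverse in `decTriv`.
      change (C.α (B.triv (X.src a.1.1.1) (B.act b.1.1.2 k.2)).2 (C.α k.2⁻¹ (k.1⁻¹ * b.2)))⁻¹ =
        (C.α (B.triv (X.src a.1.1.1) b.1.1.2).2 b.2)⁻¹ *
          C.α (B.triv (X.src a.1.1.1) b.1.1.2).2 k.1
      rw [key]
      simp

theorem isPrincipalTwoBundle_decorated :
    IsPrincipalTwoBundle C.toLieTwoGroup (B.decorated C) X B.proj B.decProj B.act
      (B.decAct C) where
  proj_hom :=
    { smooth_obj := B.isPrincipalBundle.smooth_proj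
      smooth_mor := B.contMDiff_decProj
      map_src := fun a => a.1.2
      map_tgt := fun a => (B.proj_decTgt C a).symm
      map_unit := fun _ => rfl
      map_comp := fun _ _ _ _ => rfl }
  act_hom :=
    { smooth_obj := B.isPrincipalBundle.smooth_act
      smooth_mor := B.contMDiff_decAct C
      map_src := fun _ => rfl
      map_tgt := by
        rintro ⟨⟨⟨⟨γ, p⟩, hq⟩, h⟩, ⟨k, g⟩⟩
        have hq' : X.src γ = B.proj (B.act p g) :=
          hq.trans (B.isPrincipalBundle.proj_act _ _).symm
        change B.act (B.μ ⟨(γ, B.act p g), hq'⟩) (C.τ (C.α g⁻¹ (k⁻¹ * h))⁻¹) =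
          B.act (B.act (B.μ ⟨(γ, p), hq⟩) (C.τ h⁻¹)) (C.τ k * g)
        rw [← B.μ_act _ _ _ hq, ← B.isPrincipalBundle.act_mul, ← B.isPrincipalBundle.act_mul]
        congr 1
        -- Under `τ`, the automorphism `α_{g⁻¹}` becomes conjugation by `g⁻¹`, whose left factor
        -- cancels the `g` coming from `p g`.
        rw [← map_inv (C.α g⁻¹), C.τ_α]
        simp [mul_assoc]
      map_unit := by
        rintro ⟨p, g⟩
        refine Prod.ext (Subtype.ext (Prod.ext ?_ rfl)) ?_
        · exact congrArg X.unit (B.isPrincipalBundle.proj_act _ _).symm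
        · change C.α g⁻¹ (1⁻¹ * 1) = 1
          simp
      map_comp := by
        rintro ⟨b, ⟨k₂, g₂⟩⟩ ⟨a, ⟨k₁, g₁⟩⟩ h h'
        -- Composability in the 2-group. By the Peiffer identity, `α_{g₂⁻¹}` is then `α_{g₁⁻¹}`
        -- after conjugation by `k₁⁻¹`, which moves `k₁⁻¹` past `k₂⁻¹ b.2` to give `(k₂ k₁)⁻¹` on
        -- the left.
        have e : g₂ = C.τ k₁ * g₁ := congrArg Prod.snd h
        refine Prod.ext rfl ?_
        change C.α g₁⁻¹ ((k₂ * k₁)⁻¹ * (b.2 * a.2)) =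
          C.α g₂⁻¹ (k₂⁻¹ * b.2) * C.α g₁⁻¹ (k₁⁻¹ * a.2)
        rw [e, mul_inv_rev, mul_inv_rev, ← map_inv C.τ, map_mul C.α, MulAut.mul_apply, C.α_τ,
          ← map_mul]
        simp [mul_assoc] }
  principal_obj := B.isPrincipalBundle
  principal_mor := B.isPrincipalBundle_decProj C

end PrincipalBundleOver

end

theorem mainTheorem5 {E₀ H₀ X₀ E₁ H₁ X₁ EG HG G EH HH H EP HP P : Type*}
    [NormedAddCommGroup E₀] [NormedSpace ℝ E₀] [TopologicalSpace H₀]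
    [NormedAddCommGroup E₁] [NormedSpace ℝ E₁] [TopologicalSpace H₁]
    {I₀ : ModelWithCorners ℝ E₀ H₀} [TopologicalSpace X₀] [ChartedSpace H₀ X₀]
    {I₁ : ModelWithCorners ℝ E₁ H₁} [TopologicalSpace X₁] [ChartedSpace H₁ X₁]
    [NormedAddCommGroup EG] [NormedSpace ℝ EG] [TopologicalSpace HG]
    [NormedAddCommGroup EH] [NormedSpace ℝ EH] [TopologicalSpace HH]
    [NormedAddCommGroup EP] [NormedSpace ℝ EP] [TopologicalSpace HP]
    {IG : ModelWithCorners ℝ EG HG} [TopologicalSpace G] [ChartedSpace HG G] [Group G]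
    {IH : ModelWithCorners ℝ EH HH} [TopologicalSpace H] [ChartedSpace HH H] [Group H]
    {IP : ModelWithCorners ℝ EP HP} [TopologicalSpace P] [ChartedSpace HP P]
    -- a Lie crossed module `(G, H, τ, α)`
    (C : LieCrossedModule IG G IH H)
    -- a Lie groupoid `X = [X₁ ⇉ X₀]` and a principal `G`-bundle `P` over it
    (X : LieGroupoid I₀ X₀ I₁ X₁) (B : PrincipalBundleOver X IG G IP P) :
    -- `s^* P` carries the manifold structure of an embedded submanifold of `X₁ × P`
    ∃ _ : ChartedSpace (ModelProd H₁ HG) B.pullback,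
      IsEmbeddedSubmanifold (I₁.prod IG) (I₁.prod IP) B.pullback ∧
      -- `s^* P × H ⇉ P` is a Lie groupoid with the stated structure maps
      ∃ 𝔼 : LieGroupoid IP P ((I₁.prod IG).prod IH) (B.pullback × H),
        𝔼.src = B.decSrc ∧
        𝔼.tgt = B.decTgt C ∧
        (∀ b a (h : 𝔼.src b = 𝔼.tgt a) (h' : B.decSrc b = B.decTgt C a),
          𝔼.comp ⟨(b, a), h⟩ = B.decComp C ⟨(b, a), h'⟩) ∧
        𝔼.unit = B.decUnit ∧
        𝔼.inv = B.decInv C ∧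
        -- and a principal bundle over `X` for the Lie 2-group of the crossed module
        IsPrincipalTwoBundle C.toLieTwoGroup 𝔼 X B.proj B.decProj B.act (B.decAct C) :=
  ⟨inferInstance, B.isEmbeddedSubmanifold_pullback, B.decorated C, rfl, rfl, fun _ _ _ _ => rfl, rfl,
    rfl, B.isPrincipalTwoBundle_decorated C⟩
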